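/- Let $N\ge 1$, let $\tau\in\mathbb C$ with $\operatorname{Im}\tau>0$, put $L=\mathbb Z+\tau\mathbb Z$ and $\mathbf e(z)=\exp(2\pi\sqrt{-1}\,z)$, and for $a,b\in\mathbb C$ and $\operatorname{Im}\sigma>0$ let $$\theta\begin{bmatrix}a\\ b\end{bmatrix}(z,\sigma)=\sum_{j\in\mathbb Z}\mathbf e\Big((j+a)^2\frac{\sigma}{2}+(j+a)(z+b)\Big),\qquad \vartheta(z,\tau)=\theta\begin{bmatrix}1/2\\ 1/2\end{bmatrix}(z,\tau),\qquad \phi(u,z)=\frac{\vartheta(u+z,\tau)\,\vartheta'(0,\tau)}{\vartheta(u,\tau)\,\vartheta(z,\tau)},$$ where $'$ is the derivative in the first argument. Let $u=(u_1,\dots,u_N)\in\mathbb C^N$ with $\sum_j u_j=0$, and let $$\tilde\Xi_{ij}(z)=\theta\begin{bmatrix}\frac iN-\frac12\\ \frac N2\end{bmatrix}(z-Nu_j,N\tau)\quad(1\le i,j\le N),\qquad w_l=(-1)^l\prod_{j<k;\ j,k\ne l}\vartheta(u_k-u_j,\tau)\quad(1\le l\le N).$$ (1) The matrix $\tilde\Xi(0)$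 is singular, and the column vector $w=(w_1,\dots,w_N)$ satisfies $\tilde\Xi(0)w=0$. Assume from now on that the $u_j$ are pairwise distinct modulo $L$. (2) $w\neq0$, and the kernel of $\tilde\Xi(0)$ is the line spanned by $w$. (3) Let $\Xi(z)=\tilde\Xi(z)\,\mathrm{diag}(w_1,\dots,w_N)$, let $Q=\mathrm{diag}(\mathbf e(1/N),\mathbf e(2/N),\dots,1)$, and let $\Lambda$ be the cyclic shift matrix with $\Lambda_{k,k+1}=1$ for $1\le k<N$, $\Lambda_{N,1}=1$ and zeros elsewhere. Then $\Xi$ is entire in $z$ and $$\Xi(z+1)=-Q\,\Xi(z),\qquad \Xi(z+\tau)=-\mathbf e\Big(-\frac{\tau}{2N}-\frac zN\Big)\Lambda\,\Xi(z)\,\mathrm{diag}(\mathbf e(u_1),\dots,\mathbf e(u_N)).$$ The matrix $\Xi(z)$ is invertible for $z\notin L$, $\det\Xi(z)$ has a simple zero at $z=0$, and $\ker\Xi(0)$ is spanned by $(1,\dots,1)$. For $\nu\in\mathbb C$ and $v\in\mathbb C^N$ with $\sum_jv_j=0$ let $L^{CM}(z)$ be the Calogero–Moser Lax operator, with diagonal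 entries $v_j$ and off-diagonal entries $L^{CM}_{jk}(z)=\nu\,\phi(u_j-u_k,z)$, and let $E_{mn}=\mathbf e\big(\frac{mn}{2N}\big)Q^m\Lambda^n$. Then there are numbers $S_{mn}\in\mathbb C$ ($0\le m,n\le N-1$, $(m,n)\ne(0,0)$) such that for all $z\notin L$ $$\Xi(z)\,L^{CM}(z)\,\Xi(z)^{-1}=L^{rot}(z):=\sum_{(m,n)\neq(0,0)}S_{mn}\,\mathbf e\Big(-\frac{nz}{N}\Big)\phi\Big(-\frac{m+n\tau}{N},z\Big)E_{mn},$$ which is the Lax operator of the elliptic $\mathrm{SL}(N,\mathbb C)$-rotator; and if $\nu\ne0$, then $\mathbf S=\sum S_{mn}E_{mn}$ equals $g^{-1}p\,g$ for some $g\in\mathrm{SL}(N,\mathbb C)$, where $p$ is the matrix with zeros on the diagonal and $\nu$ off the diagonal. -/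

import Mathlib

open scoped BigOperators Matrix

namespace CMRotator

/-- The exponential `e(z) = exp (2 π √-1 z)`. -/
noncomputable def e (z : ℂ) : ℂ := Complex.exp (2 * Real.pi * Complex.I * z)

/-- The period lattice `ℤ + τ ℤ`. -/
def lattice (τ : ℂ) : Set ℂ := {w | ∃ m n : ℤ, w = m + n * τ}

/-- The theta function with characteristic
`θ[a; b](z, τ) = ∑ j ∈ ℤ, e ((j + a)² τ / 2 + (j + a) (z + b))`
(the series converges absolutely when `0 < Im τ`). -/
noncomputable def thetaChar (a b z τ : ℂ) : ℂ :=
  ∑' j : ℤ, e (((j : ℂ) + a) ^ 2 * (τ / 2) + ((j : ℂ) + a) * (z + b))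

/-- The odd theta function `ϑ(z, τ) = θ[1/2; 1/2](z, τ)`. -/
noncomputable def vartheta (z τ : ℂ) : ℂ := thetaChar (1 / 2) (1 / 2) z τ

/-- `φ(u, z) = ϑ(u + z) ϑ'(0) / (ϑ(u) ϑ(z))`. -/
noncomputable def phi (τ u z : ℂ) : ℂ :=
  vartheta (u + z) τ * deriv (fun w => vartheta w τ) 0 / (vartheta u τ * vartheta z τ)

variable (N : ℕ)

/-! Rows and columns are numbered `1, …, N`: the element `i : Fin N` stands for the
number `i + 1`. -/

/-- The matrix `θ[i/N - 1/2; N/2](z - N u_j, N τ)`, `i, j = 1, …, N`. -/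
noncomputable def XiTilde (τ : ℂ) (u : Fin N → ℂ) (z : ℂ) : Matrix (Fin N) (Fin N) ℂ :=
  Matrix.of fun i j =>
    thetaChar ((((i : ℕ) : ℂ) + 1) / N - 1 / 2) ((N : ℂ) / 2) (z - N * u j) (N * τ)

/-- The column vector `(-1)^l ∏_{j < k; j, k ≠ l} ϑ(u_k - u_j, τ)`, `l = 1, …, N`. -/
noncomputable def kerVec (τ : ℂ) (u : Fin N → ℂ) (l : Fin N) : ℂ :=
  (-1 : ℂ) ^ ((l : ℕ) + 1) *
    ∏ p : Fin N × Fin N with p.1 < p.2 ∧ p.1 ≠ l ∧ p.2 ≠ l, vartheta (u p.2 - u p.1) τ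

/-- The singular gauge transformation: `XiTilde` times the diagonal matrix of `kerVec`. -/
noncomputable def Xi (τ : ℂ) (u : Fin N → ℂ) (z : ℂ) : Matrix (Fin N) (Fin N) ℂ :=
  XiTilde N τ u z * Matrix.diagonal (kerVec N τ u)

/-- The Lax operator of the elliptic Calogero-Moser system with coupling constant `ν`:
`v_j` on the diagonal and `ν φ(u_j - u_k, z)` off the diagonal. -/
noncomputable def laxCM (τ ν : ℂ) (v u : Fin N → ℂ) (z : ℂ) : Matrix (Fin N) (Fin N) ℂ :=
  Matrix.of fun j k => if j = k then v j else ν * phi τ (u j - u k) z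

/-- The residue at `z = 0` of the Calogero-Moser Lax operator: `0` on the diagonal and `ν`
off the diagonal. -/
def residueCM (ν : ℂ) : Matrix (Fin N) (Fin N) ℂ :=
  Matrix.of fun j k => if j = k then 0 else ν

/-- `Q = diag (e(1/N), …, e(m/N), …, 1)`. -/
noncomputable def Q : Matrix (Fin N) (Fin N) ℂ :=
  Matrix.diagonal fun k => e ((((k : ℕ) : ℂ) + 1) / N)

/-- The cyclic shift: ones at the places `(k, k + 1)` and `(N, 1)`. -/
def Lam : Matrix (Fin N) (Fin N) ℂ :=
  Matrix.of fun j k => if (k : ℕ) = ((j : ℕ) + 1) % N then 1 else 0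

/-- The multiplier `-e(-τ/(2N) - z/N) Λ`. -/
noncomputable def LamTilde (τ z : ℂ) : Matrix (Fin N) (Fin N) ℂ :=
  (-e (-τ / (2 * N) - z / N)) • Lam N

/-- The index set of the sin-algebra basis: pairs `(m, n)` with `0 ≤ m, n ≤ N - 1` and
`(m, n) ≠ (0, 0)`. -/
abbrev SinIndex : Type := {p : Fin N × Fin N // ¬((p.1 : ℕ) = 0 ∧ (p.2 : ℕ) = 0)}

/-- The sin-algebra basis `E_{mn} = e(mn/(2N)) Q^m Λ^n` of `sl(N, ℂ)`. -/
noncomputable def sinBasis (p : SinIndex N) : Matrix (Fin N) (Fin N) ℂ :=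
  e (((p.1.1 : ℕ) : ℂ) * ((p.1.2 : ℕ) : ℂ) / (2 * N)) •
    (Q N ^ (p.1.1 : ℕ) * Lam N ^ (p.1.2 : ℕ))

/-- The rotator variable `S = ∑ S_{mn} E_{mn}`, an element of `sl(N, ℂ)`. -/
noncomputable def rotVar (S : SinIndex N → ℂ) : Matrix (Fin N) (Fin N) ℂ :=
  ∑ p, S p • sinBasis N p

/-- `φ[m; n](z) = e(-n z / N) φ(-(m + n τ)/N, z)`. -/
noncomputable def phiChar (τ : ℂ) (p : SinIndex N) (z : ℂ) : ℂ :=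
  e (-(((p.1.2 : ℕ) : ℂ) * z / N)) *
    phi τ (-((((p.1.1 : ℕ) : ℂ) + ((p.1.2 : ℕ) : ℂ) * τ) / N)) z

/-- The Lax operator of the elliptic rotator: `∑ S_{mn} φ[m; n](z) E_{mn}`. -/
noncomputable def laxRot (τ : ℂ) (S : SinIndex N → ℂ) (z : ℂ) : Matrix (Fin N) (Fin N) ℂ :=
  ∑ p, (S p * phiChar N τ p z) • sinBasis N p

end CMRotator

namespace CMRotator

open Complex Filter Topology

/-! ### The exponential and the lattice -/

lemma e_add (x y : ℂ) : e (x + y) = e x * e y := by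
  simp only [e, mul_add, Complex.exp_add]

@[simp] lemma e_zero : e 0 = 1 := by simp [e]

lemma e_ne_zero (x : ℂ) : e x ≠ 0 := Complex.exp_ne_zero _

lemma e_neg (x : ℂ) : e (-x) = (e x)⁻¹ := by simp only [e, mul_neg, Complex.exp_neg]

lemma e_sub (x y : ℂ) : e (x - y) = e x / e y := by
  simp only [e, mul_sub, Complex.exp_sub]

lemma e_eq_one_iff (x : ℂ) : e x = 1 ↔ ∃ n : ℤ, x = n := by
  rw [e, Complex.exp_eq_one_iff]
  have h : (2 * (Real.pi : ℂ) * I) ≠ 0 := Complex.two_pi_I_ne_zero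
  refine exists_congr fun n => ⟨fun H => mul_left_cancel₀ h (by rw [H]; ring), fun H => ?_⟩
  rw [H]; ring

@[simp] lemma e_int (n : ℤ) : e n = 1 := (e_eq_one_iff _).2 ⟨n, rfl⟩

@[simp] lemma e_nat (n : ℕ) : e n = 1 := (e_eq_one_iff _).2 ⟨n, by simp⟩

@[simp] lemma e_one : e 1 = 1 := by simpa using e_nat 1

lemma e_half : e (1 / 2) = -1 := by
  rw [e, show 2 * (Real.pi : ℂ) * I * (1 / 2) = Real.pi * I by ring, Complex.exp_pi_mul_I]

lemma e_nat_mul (n : ℕ) (x : ℂ) : e (n * x) = e x ^ n := by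
  rw [e, e, ← Complex.exp_nat_mul]; congr 1; ring

lemma norm_e (x : ℂ) : ‖e x‖ = Real.exp (-(2 * Real.pi * x.im)) := by
  rw [e, Complex.norm_exp]
  simp

lemma norm_e_ofReal (x : ℝ) : ‖e x‖ = 1 := by simp [norm_e]

lemma differentiable_e : Differentiable ℂ e := by
  unfold e; fun_prop

lemma hasDerivAt_e (x : ℂ) : HasDerivAt e (2 * Real.pi * I * e x) x := by
  have := ((hasDerivAt_id x).const_mul (2 * Real.pi * I)).cexp
  rw [mul_one, mul_comm (Complex.exp _)] at this
  exact this

lemma lattice_countable (τ : ℂ) : (lattice τ).Countable := by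
  have : lattice τ = Set.range fun p : ℤ × ℤ => ((p.1 : ℂ) + p.2 * τ) := by
    ext w; simp [lattice, eq_comm]
  rw [this]; exact Set.countable_range _

lemma one_mem_lattice (τ : ℂ) : (1 : ℂ) ∈ lattice τ := ⟨1, 0, by simp⟩

lemma tau_mem_lattice (τ : ℂ) : τ ∈ lattice τ := ⟨0, 1, by simp⟩

lemma add_mem_lattice {τ x y : ℂ} (hx : x ∈ lattice τ) (hy : y ∈ lattice τ) :
    x + y ∈ lattice τ := by
  obtain ⟨m, n, rfl⟩ := hx
  obtain ⟨k, l, rfl⟩ := hy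
  exact ⟨m + k, n + l, by push_cast; ring⟩

lemma neg_mem_lattice {τ x : ℂ} (hx : x ∈ lattice τ) : -x ∈ lattice τ := by
  obtain ⟨m, n, rfl⟩ := hx
  exact ⟨-m, -n, by push_cast; ring⟩

lemma neg_mem_lattice_iff {τ x : ℂ} : -x ∈ lattice τ ↔ x ∈ lattice τ :=
  ⟨fun h => by simpa using neg_mem_lattice h, neg_mem_lattice⟩

lemma add_mem_lattice_iff {τ x y : ℂ} (hy : y ∈ lattice τ) :
    x + y ∈ lattice τ ↔ x ∈ lattice τ :=
  ⟨fun h => by simpa using add_mem_lattice h (neg_mem_lattice hy), fun h => add_mem_lattice h hy⟩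

lemma dense_compl_lattice (τ : ℂ) : Dense (lattice τ)ᶜ :=
  (lattice_countable τ).dense_compl ℂ

lemma dense_affine_notMem_lattice (τ : ℂ) {ι : Type*} [Countable ι] (a b : ι → ℂ)
    (ha : ∀ i, a i ≠ 0) : Dense {t : ℂ | ∀ i, a i * t + b i ∉ lattice τ} := by
  have h : {t : ℂ | ∀ i, a i * t + b i ∉ lattice τ} =
      (⋃ i, (fun t => a i * t + b i) ⁻¹' lattice τ)ᶜ := by
    ext t; simp
  rw [h]
  refine Set.Countable.dense_compl ℂ (Set.countable_iUnion fun i => ?_)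
  refine (lattice_countable τ).preimage fun x y hxy => ?_
  simpa [ha i] using hxy

/-! ### Division and Liouville's theorem for quasi-periodic functions -/

lemma exists_entire_quotient {f h : ℂ → ℂ} (hf : Differentiable ℂ f) (hh : Differentiable ℂ h)
    (h0 : ∀ z, h z = 0 → f z = 0 ∧ deriv h z ≠ 0) :
    ∃ g : ℂ → ℂ, Differentiable ℂ g ∧ ∀ z, f z = h z * g z := by
  classical
  refine ⟨fun z => if h z = 0 then deriv f z / deriv h z else f z / h z, fun z₀ => ?_,
    fun z => ?_⟩
  · by_cases hz : h z₀ = 0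
    · obtain ⟨hf0, hd⟩ := h0 z₀ hz
      have hdf : Differentiable ℂ (dslope f z₀) := by
        rw [← differentiableOn_univ] at hf ⊢
        exact (Complex.differentiableOn_dslope univ_mem).2 hf
      have hdh : Differentiable ℂ (dslope h z₀) := by
        rw [← differentiableOn_univ] at hh ⊢
        exact (Complex.differentiableOn_dslope univ_mem).2 hh
      have hne : dslope h z₀ z₀ ≠ 0 := by rwa [dslope_same]
      refine ((hdf z₀).fun_div (hdh z₀) hne).congr_of_eventuallyEq ?_
      filter_upwards [(hdh z₀).continuousAt.eventually_ne hne] with z hz'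
      have e1 : h z = (z - z₀) * dslope h z₀ z := by
        have := sub_smul_dslope h z₀ z
        rw [smul_eq_mul, hz, sub_zero] at this; exact this.symm
      have e2 : f z = (z - z₀) * dslope f z₀ z := by
        have := sub_smul_dslope f z₀ z
        rw [smul_eq_mul, hf0, sub_zero] at this; exact this.symm
      by_cases hzz : z = z₀
      · subst hzz; simp [hz]
      · have hs : z - z₀ ≠ 0 := sub_ne_zero.2 hzz
        rw [if_neg (by rw [e1]; exact mul_ne_zero hs hz'), e1, e2, mul_div_mul_left _ _ hs]
    · refine ((hf z₀).fun_div (hh z₀) hz).congr_of_eventuallyEq ?_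
      filter_upwards [(hh z₀).continuousAt.eventually_ne hz] with z hz'
      rw [if_neg hz']
  · by_cases hz : h z = 0
    · simp [hz, (h0 z hz).1]
    · simp only [if_neg hz]; field_simp

/-- Entire functions with the multipliers `α` and `β e(-d z)` of the periods `1` and `τ`. -/
structure QuasiPeriodic (τ : ℂ) (d : ℕ) (α β : ℂ) (f : ℂ → ℂ) : Prop where
  differentiable : Differentiable ℂ f
  add_one : ∀ z, f (z + 1) = α * f z
  add_tau : ∀ z, f (z + τ) = β * e (-(d * z)) * f z

namespace QuasiPeriodic

variable {τ : ℂ} {d d' : ℕ} {α β α' β' : ℂ} {f g : ℂ → ℂ}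

lemma apply_eq_apply (hτ : 0 < τ.im) (hf : QuasiPeriodic τ 0 α β f) (hα : ‖α‖ = 1)
    (hβ : ‖β‖ = 1) (z w : ℂ) : f z = f w := by
  refine hf.differentiable.apply_eq_apply_of_bounded ?_ z w
  have p1 : Function.Periodic (fun z => ‖f z‖) 1 := fun z => by simp [hf.add_one, hα]
  have p2 : Function.Periodic (fun z => ‖f z‖) τ := fun z => by simp [hf.add_tau, hβ]
  have hK : IsCompact ((fun p : ℝ × ℝ => f (p.1 + p.2 * τ)) ''
      (Set.Icc (0 : ℝ) 1 ×ˢ Set.Icc (0 : ℝ) 1)) := by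
    refine (isCompact_Icc.prod isCompact_Icc).image ?_
    exact hf.differentiable.continuous.comp (by fun_prop)
  obtain ⟨C, hC⟩ := hK.isBounded.exists_norm_le
  refine isBounded_iff_forall_norm_le.2 ⟨C, ?_⟩
  rintro _ ⟨z, rfl⟩
  set s : ℝ := z.im / τ.im
  set r : ℝ := z.re - s * τ.re
  have hz : z = (Int.fract r + Int.fract s * τ) + ⌊r⌋ * 1 + ⌊s⌋ * τ := by
    have h1 : ((Int.fract r : ℝ) : ℂ) + ⌊r⌋ = r := by exact_mod_cast Int.fract_add_floor r
    have h2 : ((Int.fract s : ℝ) : ℂ) + ⌊s⌋ = s := by exact_mod_cast Int.fract_add_floor s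
    have : z = r + s * τ := by
      apply Complex.ext
      · simp [r]
      · simp [s]; field_simp
    rw [this]
    linear_combination -h1 - τ * h2
  have e1 := p1.int_mul ⌊r⌋ (Int.fract r + Int.fract s * τ)
  have e2 := p2.int_mul ⌊s⌋ (Int.fract r + Int.fract s * τ + ⌊r⌋ * 1)
  rw [hz, e2, e1]
  refine hC _ ⟨(Int.fract r, Int.fract s), ⟨⟨?_, ?_⟩, ?_, ?_⟩, rfl⟩
  exacts [Int.fract_nonneg _, (Int.fract_lt_one _).le, Int.fract_nonneg _, (Int.fract_lt_one _).le]

lemma eq_zero (hτ : 0 < τ.im) (hf : QuasiPeriodic τ 0 α β f) (hα : ‖α‖ = 1)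
    (hβ : ‖β‖ = 1) (h : α ≠ 1 ∨ β ≠ 1) (z : ℂ) : f z = 0 := by
  have hc := hf.apply_eq_apply hτ hα hβ
  by_contra hz
  rcases h with h | h
  · exact h (mul_right_cancel₀ hz (by rw [← hf.add_one, one_mul]; exact hc _ _))
  · refine h (mul_right_cancel₀ hz ?_)
    have := hf.add_tau z
    simp only [Nat.cast_zero, zero_mul, neg_zero, e_zero, mul_one] at this
    rw [← this, one_mul]; exact hc _ _

lemma eq_zero_of_notMem_lattice (hτ : 0 < τ.im) {s : ℂ} (hf : QuasiPeriodic τ 0 1 (e s) f)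
    (hs : s ∉ lattice τ) (z : ℂ) : f z = 0 := by
  set s₂ : ℝ := s.im / τ.im
  set s₁ : ℝ := s.re - s₂ * τ.re
  have hs12 : s = s₁ + s₂ * τ := by
    apply Complex.ext
    · simp [s₁]
    · simp [s₂]; field_simp
  have key : QuasiPeriodic τ 0 (e ((-s₂ : ℝ) : ℂ)) (e s₁) fun z => e (-(s₂ * z)) * f z := by
    refine ⟨(differentiable_e.comp (by fun_prop)).mul hf.differentiable, fun z => ?_, fun z => ?_⟩
    · rw [hf.add_one, one_mul, ← mul_assoc, ← e_add]; congr 2; push_cast; ring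
    · rw [hf.add_tau]
      simp only [Nat.cast_zero, zero_mul, neg_zero, e_zero, mul_one]
      rw [← mul_assoc, ← mul_assoc, ← e_add, ← e_add]; congr 2
      linear_combination hs12
  have hne : e ((-s₂ : ℝ) : ℂ) ≠ 1 ∨ e s₁ ≠ 1 := by
    by_contra! h
    obtain ⟨n, hn⟩ := (e_eq_one_iff _).1 h.1
    obtain ⟨m, hm⟩ := (e_eq_one_iff _).1 h.2
    refine hs ⟨m, -n, ?_⟩
    rw [hs12, hm]
    push_cast at hn ⊢
    rw [← hn]; ring
  have := key.eq_zero hτ (norm_e_ofReal _) (norm_e_ofReal _) hne z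
  exact (mul_eq_zero.1 this).resolve_left (e_ne_zero _)

lemma eq_zero_of_add_mem (hα : α ≠ 0) (hβ : β ≠ 0) (hf : QuasiPeriodic τ d α β f) {z w : ℂ}
    (hw : w ∈ lattice τ) : f (z + w) = 0 ↔ f z = 0 := by
  have p1 : Function.Periodic (fun z => f z = 0) 1 := fun z => by simp [hf.add_one, hα]
  have p2 : Function.Periodic (fun z => f z = 0) τ := fun z => by
    simp [hf.add_tau, hβ, e_ne_zero]
  obtain ⟨m, n, rfl⟩ := hw
  have e1 := p1.int_mul m z
  have e2 := p2.int_mul n (z + m * 1)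
  simp only [mul_one] at e1 e2
  rw [← add_assoc, e2, e1]

lemma mul (hf : QuasiPeriodic τ d α β f) (hg : QuasiPeriodic τ d' α' β' g) :
    QuasiPeriodic τ (d + d') (α * α') (β * β') fun z => f z * g z where
  differentiable := hf.differentiable.mul hg.differentiable
  add_one z := by rw [hf.add_one, hg.add_one]; ring
  add_tau z := by
    rw [hf.add_tau, hg.add_tau, show -((d + d' : ℕ) * z) = -(d * z) + -(d' * z) by
      push_cast; ring, e_add]; ring

lemma add (hf : QuasiPeriodic τ d α β f) (hg : QuasiPeriodic τ d α β g) :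
    QuasiPeriodic τ d α β fun z => f z + g z where
  differentiable := hf.differentiable.add hg.differentiable
  add_one z := by rw [hf.add_one, hg.add_one]; ring
  add_tau z := by rw [hf.add_tau, hg.add_tau]; ring

lemma const_mul (c : ℂ) (hf : QuasiPeriodic τ d α β f) :
    QuasiPeriodic τ d α β fun z => c * f z where
  differentiable := hf.differentiable.const_mul c
  add_one z := by rw [hf.add_one]; ring
  add_tau z := by rw [hf.add_tau]; ring

lemma sum {ι : Type*} (s : Finset ι) {F : ι → ℂ → ℂ}
    (hF : ∀ i ∈ s, QuasiPeriodic τ d α β (F i)) :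
    QuasiPeriodic τ d α β fun z => ∑ i ∈ s, F i z where
  differentiable := Differentiable.fun_sum fun i hi => (hF i hi).differentiable
  add_one z := by rw [Finset.mul_sum]; exact Finset.sum_congr rfl fun i hi => (hF i hi).add_one z
  add_tau z := by rw [Finset.mul_sum]; exact Finset.sum_congr rfl fun i hi => (hF i hi).add_tau z

lemma prod {ι : Type*} (s : Finset ι) {F : ι → ℂ → ℂ} {δ : ι → ℕ} {a b : ι → ℂ}
    (hF : ∀ i ∈ s, QuasiPeriodic τ (δ i) (a i) (b i) (F i)) :
    QuasiPeriodic τ (∑ i ∈ s, δ i) (∏ i ∈ s, a i) (∏ i ∈ s, b i) fun z => ∏ i ∈ s, F i z := by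
  classical
  induction s using Finset.induction_on with
  | empty => exact ⟨by simp, by simp, by simp⟩
  | insert i s hi ih =>
    simp only [Finset.sum_insert hi, Finset.prod_insert hi]
    exact (hF i (by simp)).mul (ih fun j hj => hF j (by simp [hj]))

lemma shift (hf : QuasiPeriodic τ d α β f) (c : ℂ) :
    QuasiPeriodic τ d α (β * e (d * c)) fun z => f (z - c) where
  differentiable := hf.differentiable.comp (by fun_prop)
  add_one z := by rw [show z + 1 - c = z - c + 1 by ring, hf.add_one]
  add_tau z := by
    rw [show z + τ - c = z - c + τ by ring, hf.add_tau, mul_assoc β (e (d * c)), ← e_add]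
    congr 3; ring

/-- The quotient of quasi-periodic functions, when it is entire. -/
lemma of_mul (hf : QuasiPeriodic τ (d + d') α β f) (hg : QuasiPeriodic τ d' α' β' g)
    (hα' : α' ≠ 0) (hβ' : β' ≠ 0) (hd : Dense {z | g z ≠ 0}) {h : ℂ → ℂ}
    (hh : Differentiable ℂ h) (hfg : ∀ z, f z = g z * h z) :
    QuasiPeriodic τ d (α / α') (β / β') h where
  differentiable := hh
  add_one := by
    refine fun z => congrFun (Continuous.ext_on hd (hh.continuous.comp (by fun_prop))
      (hh.continuous.const_mul _) fun z hz => ?_ : (fun z => h (z + 1)) = fun z => α / α' * h z) z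
    have h1 := hfg (z + 1)
    rw [hf.add_one, hg.add_one, hfg] at h1
    refine mul_left_cancel₀ hz ?_
    field_simp
    linear_combination -h1
  add_tau := by
    have hc : Continuous fun z => β / β' * e (-(d * z)) * h z :=
      (continuous_const.mul (differentiable_e.continuous.comp (by fun_prop))).mul hh.continuous
    refine fun z => congrFun (Continuous.ext_on hd (hh.continuous.comp (by fun_prop))
      hc fun z hz => ?_ : (fun z => h (z + τ)) = _) z
    have h1 := hfg (z + τ)
    rw [hf.add_tau, hg.add_tau, hfg, show -((d + d' : ℕ) * z) = -(d * z) + -(d' * z) by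
      push_cast; ring, e_add] at h1
    refine mul_left_cancel₀ (mul_ne_zero hz (e_ne_zero (-(d' * z)))) ?_
    generalize e (-(d * z)) = E at h1 ⊢
    field_simp
    linear_combination -h1

end QuasiPeriodic

/-! ### Theta series -/

lemma thetaChar_eq_jacobiTheta₂ (a b z τ : ℂ) :
    thetaChar a b z τ = e (a ^ 2 * (τ / 2) + a * (z + b)) * jacobiTheta₂ (z + b + a * τ) τ := by
  rw [thetaChar, jacobiTheta₂, ← tsum_mul_left]
  refine tsum_congr fun j => ?_
  rw [jacobiTheta₂_term, e, e, ← Complex.exp_add]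
  congr 1; ring

lemma differentiable_jacobiTheta₂ {τ : ℂ} (hτ : 0 < τ.im) :
    Differentiable ℂ fun z => jacobiTheta₂ z τ :=
  fun z => differentiableAt_jacobiTheta₂_fst z hτ

lemma differentiable_thetaChar (a b : ℂ) {τ : ℂ} (hτ : 0 < τ.im) :
    Differentiable ℂ fun z => thetaChar a b z τ := by
  simp only [thetaChar_eq_jacobiTheta₂]
  exact (differentiable_e.comp (by fun_prop)).mul
    ((differentiable_jacobiTheta₂ hτ).comp (by fun_prop))

lemma thetaChar_add_int (a b z τ : ℂ) (n : ℤ) :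
    thetaChar a b (z + n) τ = e (n * a) * thetaChar a b z τ := by
  rw [thetaChar, thetaChar, ← tsum_mul_left]
  refine tsum_congr fun j => ?_
  rw [show ((j : ℂ) + a) ^ 2 * (τ / 2) + (j + a) * (z + n + b) =
    (j * n : ℤ) + (n * a + ((j + a) ^ 2 * (τ / 2) + (j + a) * (z + b))) by push_cast; ring,
    e_add, e_int, one_mul, e_add]

lemma thetaChar_add_one (a b z τ : ℂ) :
    thetaChar a b (z + 1) τ = e a * thetaChar a b z τ := by
  simpa using thetaChar_add_int a b z τ 1

lemma thetaChar_add_mul (a b z τ c : ℂ) :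
    thetaChar a b (z + c * τ) τ =
      e (-(c ^ 2 * τ / 2) - c * (z + b)) * thetaChar (a + c) b z τ := by
  rw [thetaChar, thetaChar, ← tsum_mul_left]
  refine tsum_congr fun j => ?_
  rw [← e_add]
  congr 1; ring

lemma thetaChar_char_add_one (a b z τ : ℂ) :
    thetaChar (a + 1) b z τ = thetaChar a b z τ := by
  rw [thetaChar, thetaChar, ← (Equiv.addRight (1 : ℤ)).tsum_eq
    fun j : ℤ => e (((j : ℂ) + a) ^ 2 * (τ / 2) + ((j : ℂ) + a) * (z + b))]
  refine tsum_congr fun j => ?_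
  simp only [Equiv.coe_addRight]
  congr 1; push_cast; ring

lemma vartheta_neg (z τ : ℂ) : vartheta (-z) τ = -vartheta z τ := by
  rw [vartheta, vartheta, thetaChar, thetaChar, ← tsum_neg, ← (Equiv.subLeft (-1 : ℤ)).tsum_eq]
  refine tsum_congr fun j => ?_
  have h : e (-((j : ℂ) + 1 / 2)) = -1 := by
    rw [neg_add, e_add, ← Int.cast_neg, e_int, one_mul, e_neg, e_half]; norm_num
  rw [← mul_neg_one (e _), ← h, ← e_add]
  congr 1; simp only [Equiv.subLeft_apply]; push_cast; ring

lemma vartheta_zero (τ : ℂ) : vartheta 0 τ = 0 := by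
  have := vartheta_neg 0 τ
  rw [neg_zero] at this
  exact self_eq_neg.1 this

lemma quasiPeriodic_vartheta {τ : ℂ} (hτ : 0 < τ.im) :
    QuasiPeriodic τ 1 (-1) (-e (-(τ / 2))) fun z => vartheta z τ where
  differentiable := differentiable_thetaChar _ _ hτ
  add_one z := by rw [vartheta, thetaChar_add_one, e_half]; rfl
  add_tau z := by
    have := thetaChar_add_mul (1 / 2) (1 / 2) z τ 1
    rw [one_mul, thetaChar_char_add_one] at this
    rw [vartheta, this, vartheta, show -(1 ^ 2 * τ / 2) - 1 * (z + 1 / 2) =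
      -(τ / 2) + -((1 : ℕ) * z) + -(1 / 2) by push_cast; ring, e_add, e_add, e_neg (1 / 2), e_half]
    norm_num

lemma exists_jacobiTheta₂_ne_zero {τ : ℂ} (hτ : 0 < τ.im) : ∃ z, jacobiTheta₂ z τ ≠ 0 := by
  by_contra! h
  have hnorm : ∀ (n : ℤ) (x : ℝ), ‖jacobiTheta₂_term n x τ‖ = ‖jacobiTheta₂_term n 0 τ‖ := by
    intro n x; simp [norm_jacobiTheta₂_term]
  have hs : Summable fun n : ℤ => ‖jacobiTheta₂_term n 0 τ‖ :=
    ((summable_jacobiTheta₂_term_iff 0 τ).2 hτ).norm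
  have hsum : HasSum (fun n : ℤ => ∫ x in (0 : ℝ)..1, jacobiTheta₂_term n x τ)
      (∫ x in (0 : ℝ)..1, jacobiTheta₂ x τ) := by
    refine intervalIntegral.hasSum_integral_of_dominated_convergence
      (fun n _ => ‖jacobiTheta₂_term n 0 τ‖) (fun n => ?_) (fun n => ?_) ?_ ?_ ?_
    · refine Continuous.aestronglyMeasurable ?_
      unfold jacobiTheta₂_term; fun_prop
    · exact Eventually.of_forall fun x _ => (hnorm n x).le
    · exact Eventually.of_forall fun x _ => hs
    · exact intervalIntegrable_const
    · exact Eventually.of_forall fun x _ => hasSum_jacobiTheta₂_term x hτ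
  have hint : ∀ n : ℤ, ∫ x in (0 : ℝ)..1, jacobiTheta₂_term n x τ = if n = 0 then 1 else 0 := by
    intro n
    split_ifs with hn
    · simp [hn, jacobiTheta₂_term]
    · have hc : (2 * Real.pi * I * n : ℂ) ≠ 0 :=
        mul_ne_zero Complex.two_pi_I_ne_zero (Int.cast_ne_zero.2 hn)
      have : ∀ x : ℝ, jacobiTheta₂_term n x τ =
          cexp (Real.pi * I * n ^ 2 * τ) * cexp (2 * Real.pi * I * n * x) := by
        intro x; rw [jacobiTheta₂_term, ← Complex.exp_add, add_comm]
      simp only [this]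
      rw [intervalIntegral.integral_const_mul, integral_exp_mul_complex hc]
      have h1 : cexp (2 * Real.pi * I * n) = 1 := by
        rw [Complex.exp_eq_one_iff]; exact ⟨n, by ring⟩
      simp [h1]
  simp only [hint, h] at hsum
  have := hsum.unique (hasSum_ite_eq (0 : ℤ) (1 : ℂ))
  simp at this

lemma exists_thetaChar_ne_zero (a b : ℂ) {τ : ℂ} (hτ : 0 < τ.im) :
    ∃ z, thetaChar a b z τ ≠ 0 := by
  obtain ⟨z, hz⟩ := exists_jacobiTheta₂_ne_zero hτ
  refine ⟨z - b - a * τ, ?_⟩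
  rw [thetaChar_eq_jacobiTheta₂]
  refine mul_ne_zero (e_ne_zero _) ?_
  rwa [show z - b - a * τ + b + a * τ = z by ring]

/-! ### The zeros of the odd theta function -/

namespace QuasiPeriodic

variable {τ : ℂ} {d : ℕ} {α β : ℂ} {f : ℂ → ℂ}

lemma deriv_add_one (hf : QuasiPeriodic τ d α β f) (z : ℂ) :
    deriv f (z + 1) = α * deriv f z := by
  rw [← deriv_comp_add_const, ← deriv_const_mul _ (hf.differentiable z)]
  congr 1; exact funext hf.add_one

lemma deriv_add_tau (hf : QuasiPeriodic τ d α β f) {z : ℂ} (hz : f z = 0) :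
    deriv f (z + τ) = β * e (-(d * z)) * deriv f z := by
  have hd : Differentiable ℂ fun z : ℂ => β * e (-(d * z)) :=
    (differentiable_e.comp (by fun_prop)).const_mul _
  rw [← deriv_comp_add_const, show (fun z => f (z + τ)) = _ from funext hf.add_tau,
    deriv_fun_mul (hd z) (hf.differentiable z), hz]
  simp

lemma deriv_ne_zero (hα : α ≠ 0) (hβ : β ≠ 0) (hf : QuasiPeriodic τ d α β f) (h0 : f 0 = 0)
    (h0' : deriv f 0 ≠ 0) {w : ℂ} (hw : w ∈ lattice τ) : deriv f w ≠ 0 := by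
  have p1 : Function.Periodic (fun z => f z = 0 ∧ deriv f z ≠ 0) 1 := fun z => by
    simp [hf.add_one, hf.deriv_add_one, hα]
  have p2 : Function.Periodic (fun z => f z = 0 ∧ deriv f z ≠ 0) τ := fun z => by
    simp only [hf.add_tau, mul_eq_zero, hβ, e_ne_zero, false_or, eq_iff_iff]
    refine and_congr_right fun hz => ?_
    simp [hf.deriv_add_tau hz, hβ, e_ne_zero]
  obtain ⟨m, n, rfl⟩ := hw
  have e1 := p1.int_mul m 0
  have e2 := p2.int_mul n (0 + m * 1)
  simp only [mul_one, zero_add] at e1 e2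
  have h := e2.trans e1
  exact (h.mpr ⟨h0, h0'⟩).2

end QuasiPeriodic

/-- The Euler product `∏ (1 - q ^ (n + 1) w)`. -/
noncomputable def eulerProd (q w : ℂ) : ℂ := ∏' n : ℕ, (1 + -(q ^ (n + 1) * w))

section eulerProd

variable {q : ℂ}

lemma summable_norm_euler (hq : ‖q‖ < 1) (w : ℂ) : Summable fun n : ℕ => ‖-(q ^ (n + 1) * w)‖ := by
  simp only [norm_neg, norm_mul, norm_pow]
  exact ((summable_nat_add_iff 1).mpr
    (summable_geometric_of_lt_one (norm_nonneg _) hq)).mul_right _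

lemma differentiable_eulerProd (hq : ‖q‖ < 1) : Differentiable ℂ (eulerProd q) := by
  intro w
  set R := ‖w‖ + 1
  have hs : Summable fun n : ℕ => ‖q‖ ^ (n + 1) * R :=
    ((summable_nat_add_iff 1).mpr (summable_geometric_of_lt_one (norm_nonneg _) hq)).mul_right _
  have hm := Summable.hasProdLocallyUniformlyOn_nat_one_add
    (f := fun (n : ℕ) (w : ℂ) => -(q ^ (n + 1) * w)) (K := Metric.ball 0 R) Metric.isOpen_ball hs
    (Eventually.of_forall fun n x hx => by
      rw [norm_neg, norm_mul, norm_pow]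
      gcongr
      simpa using (Metric.mem_ball.1 hx).le) (fun n => by fun_prop)
  have hd := hm.differentiableOn (Eventually.of_forall fun s => by
    simpa [Finset.prod_fn] using! DifferentiableOn.finsetProd (fun _ _ ↦ by fun_prop))
    Metric.isOpen_ball
  exact hd.differentiableAt (Metric.isOpen_ball.mem_nhds (by simp [R]))

lemma eulerProd_eq (hq : ‖q‖ < 1) (w : ℂ) : eulerProd q w = (1 - q * w) * eulerProd q (q * w) := by
  have hm : Multipliable fun n : ℕ => (1 + -(q ^ (n + 1 + 1) * w)) := by
    have := multipliable_one_add_of_summable (summable_norm_euler hq (q * w))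
    refine this.congr fun n => ?_
    ring
  have h := tprod_eq_zero_mul' (f := fun n : ℕ => 1 + -(q ^ (n + 1) * w)) hm
  have h' : eulerProd q (q * w) = ∏' n : ℕ, (1 + -(q ^ (n + 1 + 1) * w)) :=
    tprod_congr fun n => by ring
  rw [h', eulerProd, h]
  congr 1; ring

lemma eulerProd_ne_zero (hq : ‖q‖ < 1) {w : ℂ} (h : ∀ n : ℕ, q ^ (n + 1) * w ≠ 1) :
    eulerProd q w ≠ 0 :=
  tprod_one_add_ne_zero_of_summable
    (fun n => by rw [← sub_eq_add_neg]; exact sub_ne_zero.2 (h n).symm) (summable_norm_euler hq w)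

end eulerProd

/-- The product side of the Jacobi triple product. -/
noncomputable def thetaProd (τ z : ℂ) : ℂ :=
  (1 - e z) * (eulerProd (e τ) (e z) * eulerProd (e τ) (e (-z)))

section

variable {τ : ℂ}

lemma norm_e_lt_one (hτ : 0 < τ.im) : ‖e τ‖ < 1 := by
  rw [norm_e, Real.exp_lt_one_iff]
  have := Real.pi_pos
  have : 0 < 2 * Real.pi * τ.im := by positivity
  linarith

lemma quasiPeriodic_thetaProd (hτ : 0 < τ.im) : QuasiPeriodic τ 1 1 (-1) (thetaProd τ) where
  differentiable := by
    have h1 := differentiable_eulerProd (norm_e_lt_one hτ)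
    exact (differentiable_e.const_sub 1).mul ((h1.comp differentiable_e).mul
      (h1.comp (differentiable_e.comp differentiable_neg)))
  add_one z := by
    simp only [thetaProd, neg_add, e_add, e_neg, e_one, inv_one, mul_one, one_mul]
  add_tau z := by
    have h1 := eulerProd_eq (norm_e_lt_one hτ) (e z)
    have h2 := eulerProd_eq (norm_e_lt_one hτ) (e (-(z + τ)))
    rw [← e_add] at h1 h2
    rw [show τ + -(z + τ) = -z by ring] at h2
    rw [thetaProd, h2, thetaProd, h1, add_comm z τ]
    simp only [Nat.cast_one, one_mul]
    have : e z * e (-z) = 1 := by rw [← e_add]; simp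
    linear_combination (1 - e (τ + z)) * eulerProd (e τ) (e (τ + z)) *
      eulerProd (e τ) (e (-z)) * this * (-1)

lemma mem_lattice_of_thetaProd_eq_zero (hτ : 0 < τ.im) {z : ℂ} (hz : thetaProd τ z = 0) :
    z ∈ lattice τ := by
  by_contra h
  have key : ∀ w : ℂ, w ∉ lattice τ → eulerProd (e τ) (e w) ≠ 0 := by
    intro w hw
    refine eulerProd_ne_zero (norm_e_lt_one hτ) fun n hn => hw ?_
    rw [← e_nat_mul, ← e_add, e_eq_one_iff] at hn
    obtain ⟨m, hm⟩ := hn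
    exact ⟨m, -(n + 1), by push_cast at hm ⊢; linear_combination hm⟩
  refine mul_ne_zero ?_ (mul_ne_zero (key z h) (key (-z) fun h' => h ?_)) hz
  · refine sub_ne_zero.2 fun h1 => h ?_
    obtain ⟨m, rfl⟩ := (e_eq_one_iff _).1 h1.symm
    exact ⟨m, 0, by simp⟩
  · simpa using neg_mem_lattice h'

lemma thetaProd_zero : thetaProd τ 0 = 0 := by simp [thetaProd]

lemma deriv_thetaProd_zero (hτ : 0 < τ.im) : deriv (thetaProd τ) 0 ≠ 0 := by
  have h1 := differentiable_eulerProd (norm_e_lt_one hτ)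
  have h2 : Differentiable ℂ fun z => eulerProd (e τ) (e z) * eulerProd (e τ) (e (-z)) :=
    (h1.comp differentiable_e).mul (h1.comp (differentiable_e.comp differentiable_neg))
  have h3 : HasDerivAt (thetaProd τ) _ 0 := ((hasDerivAt_e 0).const_sub 1).mul (h2 0).hasDerivAt
  rw [h3.deriv]
  have h4 : eulerProd (e τ) 1 ≠ 0 := by
    refine eulerProd_ne_zero (norm_e_lt_one hτ) fun n hn => ?_
    have := pow_lt_one₀ (norm_nonneg _) (norm_e_lt_one hτ) (Nat.succ_ne_zero n)
    rw [mul_one] at hn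
    rw [← norm_pow, hn] at this
    simp at this
  simp [h4]

lemma exists_vartheta_eq (hτ : 0 < τ.im) :
    ∃ c : ℂ, c ≠ 0 ∧ ∀ z, vartheta z τ = c * (e (-(z / 2)) * thetaProd τ z) := by
  have hB := quasiPeriodic_thetaProd hτ
  have hth := quasiPeriodic_vartheta hτ
  have hE : QuasiPeriodic τ (0 + 1) 1 (-1) fun z => e (z / 2) * vartheta z τ := by
    refine ⟨(differentiable_e.comp (by fun_prop)).mul hth.differentiable, fun z => ?_, fun z => ?_⟩
    · rw [hth.add_one, add_div, e_add, e_half]; ring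
    · rw [hth.add_tau, add_div, e_add, e_neg (τ / 2)]
      have := e_ne_zero (τ / 2)
      field_simp
  have hE0 : ∀ z ∈ lattice τ, e (z / 2) * vartheta z τ = 0 := by
    intro z hz
    have := (hE.eq_zero_of_add_mem one_ne_zero (by norm_num) hz (z := 0)).2 (by
      simp [vartheta_zero])
    simpa using this
  obtain ⟨g, hg, hfg⟩ := exists_entire_quotient hE.differentiable hB.differentiable
    fun z hz => ⟨hE0 z (mem_lattice_of_thetaProd_eq_zero hτ hz), hB.deriv_ne_zero one_ne_zero
      (by norm_num) thetaProd_zero (deriv_thetaProd_zero hτ)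
      (mem_lattice_of_thetaProd_eq_zero hτ hz)⟩
  have hd : Dense {z | thetaProd τ z ≠ 0} :=
    (dense_compl_lattice τ).mono fun z (hz : z ∉ lattice τ) h =>
      hz (mem_lattice_of_thetaProd_eq_zero hτ h)
  have hq := hE.of_mul hB one_ne_zero (by norm_num) hd hg hfg
  have hc := hq.apply_eq_apply hτ (by simp) (by simp)
  have heq : ∀ z, vartheta z τ = g 0 * (e (-(z / 2)) * thetaProd τ z) := by
    intro z
    have := hfg z
    rw [hc z 0] at this
    rw [e_neg]
    field_simp [e_ne_zero]
    linear_combination this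
  refine ⟨g 0, fun h0 => ?_, heq⟩
  obtain ⟨z, hz⟩ := exists_thetaChar_ne_zero (1 / 2) (1 / 2) hτ
  rw [← vartheta, heq, h0, zero_mul] at hz
  exact hz rfl

lemma vartheta_eq_zero_iff (hτ : 0 < τ.im) {z : ℂ} : vartheta z τ = 0 ↔ z ∈ lattice τ := by
  constructor
  · obtain ⟨c, hc, h⟩ := exists_vartheta_eq hτ
    intro hz
    rw [h] at hz
    exact mem_lattice_of_thetaProd_eq_zero hτ (by simpa [hc, e_ne_zero] using hz)
  · intro hz
    have := ((quasiPeriodic_vartheta hτ).eq_zero_of_add_mem (by norm_num)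
      (neg_ne_zero.2 (e_ne_zero _)) hz (z := 0)).2 (vartheta_zero τ)
    simpa using this

lemma vartheta_ne_zero (hτ : 0 < τ.im) {z : ℂ} (hz : z ∉ lattice τ) : vartheta z τ ≠ 0 :=
  fun h => hz ((vartheta_eq_zero_iff hτ).1 h)

lemma deriv_vartheta_zero (hτ : 0 < τ.im) : deriv (fun z => vartheta z τ) 0 ≠ 0 := by
  obtain ⟨c, hc, h⟩ := exists_vartheta_eq hτ
  have h2 : Differentiable ℂ fun z : ℂ => e (-(z / 2)) := differentiable_e.comp (by fun_prop)
  have h3 := (quasiPeriodic_thetaProd hτ).differentiable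
  rw [funext h, deriv_const_mul _ ((h2 0).fun_mul (h3 0)), deriv_fun_mul (h2 0) (h3 0)]
  simp [thetaProd_zero, hc, deriv_thetaProd_zero hτ]

lemma deriv_vartheta_ne_zero (hτ : 0 < τ.im) {z : ℂ} (hz : vartheta z τ = 0) :
    deriv (fun z => vartheta z τ) z ≠ 0 :=
  (quasiPeriodic_vartheta hτ).deriv_ne_zero (by norm_num) (neg_ne_zero.2 (e_ne_zero _))
    (vartheta_zero τ) (deriv_vartheta_zero hτ) ((vartheta_eq_zero_iff hτ).1 hz)

lemma dense_vartheta_sub_ne_zero (hτ : 0 < τ.im) (c : ℂ) :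
    Dense {z | vartheta (z - c) τ ≠ 0} := by
  refine (dense_affine_notMem_lattice τ (fun _ : Unit => 1) (fun _ => -c) (by simp)).mono
    fun z hz => vartheta_ne_zero hτ ?_
  simpa [sub_eq_add_neg] using hz ()

lemma quasiPeriodic_vartheta_sub (hτ : 0 < τ.im) (c : ℂ) :
    QuasiPeriodic τ 1 (-1) (-e (c - τ / 2)) fun z => vartheta (z - c) τ := by
  have := (quasiPeriodic_vartheta hτ).shift c
  rwa [neg_mul, ← e_add, Nat.cast_one, one_mul, neg_add_eq_sub] at this

lemma QuasiPeriodic.exists_eq_vartheta_mul (hτ : 0 < τ.im) {d : ℕ} {α β c : ℂ} {f : ℂ → ℂ}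
    (hα : α ≠ 0) (hβ : β ≠ 0) (hf : QuasiPeriodic τ (d + 1) α β f) (hc : f c = 0) :
    ∃ g, QuasiPeriodic τ d (-α) (-β * e (τ / 2 - c)) g ∧
      ∀ z, f z = vartheta (z - c) τ * g z := by
  have hth := quasiPeriodic_vartheta_sub hτ c
  obtain ⟨g, hg, hfg⟩ := exists_entire_quotient hf.differentiable hth.differentiable
    fun z hz => ⟨by
      have := (hf.eq_zero_of_add_mem hα hβ ((vartheta_eq_zero_iff hτ).1 hz) (z := c)).2 hc
      simpa using this, by
      rw [deriv_comp_sub_const (f := fun z => vartheta z τ)]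
      exact deriv_vartheta_ne_zero hτ hz⟩
  refine ⟨g, ?_, hfg⟩
  have := hf.of_mul hth (by norm_num) (neg_ne_zero.2 (e_ne_zero _))
    (dense_vartheta_sub_ne_zero hτ c) hg hfg
  rwa [div_neg, div_one, div_neg, div_eq_mul_inv, ← e_neg, neg_sub, ← neg_mul] at this

end

/-! ### The rows of `XiTilde` -/

/-- The entries of the row `i` of `XiTilde` as a function of one argument. -/
noncomputable def thetaRow (N : ℕ) (τ : ℂ) (i : Fin N) (x : ℂ) : ℂ :=
  thetaChar ((((i : ℕ) : ℂ) + 1) / N - 1 / 2) ((N : ℂ) / 2) (-(N * x)) (N * τ)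

variable {N : ℕ} {τ : ℂ}

lemma e_nat_half (n : ℕ) : e ((n : ℂ) / 2) = (-1) ^ n := by
  rw [← e_half, ← e_nat_mul]; congr 1; ring

lemma im_natCast_mul_pos (hN : N ≠ 0) (hτ : 0 < τ.im) : 0 < ((N : ℂ) * τ).im := by
  have : (0 : ℝ) < N := by exact_mod_cast Nat.pos_of_ne_zero hN
  simpa using mul_pos this hτ

lemma XiTilde_apply (hN : N ≠ 0) (u : Fin N → ℂ) (z : ℂ) (i j : Fin N) :
    XiTilde N τ u z i j = thetaRow N τ i (u j - z / N) := by
  have : (N : ℂ) ≠ 0 := Nat.cast_ne_zero.2 hN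
  simp only [XiTilde, thetaRow, Matrix.of_apply]
  congr 1; field_simp; ring

lemma quasiPeriodic_thetaRow (hN : N ≠ 0) (hτ : 0 < τ.im) (i : Fin N) :
    QuasiPeriodic τ N ((-1) ^ N) ((-1) ^ N * e (-(N * τ / 2))) (thetaRow N τ i) where
  differentiable :=
    (differentiable_thetaChar _ _ (im_natCast_mul_pos hN hτ)).comp (by fun_prop)
  add_one x := by
    have hN' : (N : ℂ) ≠ 0 := Nat.cast_ne_zero.2 hN
    rw [thetaRow, show -((N : ℂ) * (x + 1)) = -(N * x) + (-(N : ℤ) : ℤ) by push_cast; ring,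
      thetaChar_add_int, show ((-(N : ℤ) : ℤ) : ℂ) * ((((i : ℕ) : ℂ) + 1) / N - 1 / 2) =
        (-((i : ℕ) + 1 : ℤ) : ℤ) + (N : ℂ) / 2 by push_cast; field_simp; ring, e_add, e_int,
      one_mul, e_nat_half]
    rfl
  add_tau x := by
    rw [thetaRow, show -((N : ℂ) * (x + τ)) = -(N * x) + (-1) * (N * τ) by ring,
      thetaChar_add_mul, ← thetaChar_char_add_one,
      show -((-1) ^ 2 * (N * τ) / 2) - -1 * (-(N * x) + (N : ℂ) / 2) =
        (N : ℂ) / 2 + -(N * τ / 2) + -(N * x) by ring, e_add, e_add, e_nat_half, neg_add_cancel_right]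
    rfl

lemma e_natCast_div_injOn {a b : ℕ} (ha : a < N) (hb : b < N)
    (h : e ((a : ℂ) / N) = e ((b : ℂ) / N)) : a = b := by
  have hN' : (N : ℂ) ≠ 0 := Nat.cast_ne_zero.2 (by lia)
  have h1 : e (((a : ℂ) - b) / N) = 1 := by
    rw [sub_div, e_sub, h, div_self (e_ne_zero _)]
  obtain ⟨n, hn⟩ := (e_eq_one_iff _).1 h1
  rw [div_eq_iff hN'] at hn
  have h2 : (a : ℤ) - b = n * N := by exact_mod_cast hn
  have h3 : n < 1 := by
    by_contra! h'
    nlinarith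
  have h4 : -1 < n := by
    by_contra! h'
    nlinarith
  have : n = 0 := by lia
  subst this
  lia

lemma thetaRow_linearIndependent (hN : N ≠ 0) (hτ : 0 < τ.im) {c : Fin N → ℂ}
    (h : ∀ x, ∑ i, c i * thetaRow N τ i x = 0) : c = 0 := by
  have hN' : (N : ℂ) ≠ 0 := Nat.cast_ne_zero.2 hN
  have hshift : ∀ (i : Fin N) (x : ℂ) (k : ℕ), thetaRow N τ i (x - k / N) =
      thetaRow N τ i x * e ((((i : ℕ) : ℂ) + 1) / N - 1 / 2) ^ k := by
    intro i x k
    rw [thetaRow, show -((N : ℂ) * (x - k / N)) = -(N * x) + (k : ℤ) by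
      push_cast; field_simp; ring, thetaChar_add_int, ← e_nat_mul, mul_comm]
    rfl
  have hinj : Function.Injective fun i : Fin N => e ((((i : ℕ) : ℂ) + 1) / N - 1 / 2) := by
    intro i j hij
    simp only [add_div, add_sub_assoc] at hij
    rw [e_add, e_add] at hij
    exact Fin.ext (e_natCast_div_injOn i.2 j.2 (mul_right_cancel₀ (e_ne_zero _) hij))
  funext i
  obtain ⟨z, hz⟩ := exists_thetaChar_ne_zero ((((i : ℕ) : ℂ) + 1) / N - 1 / 2) ((N : ℂ) / 2)
    (im_natCast_mul_pos hN hτ)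
  have hz' : thetaRow N τ i (-z / N) ≠ 0 := by
    rwa [thetaRow, show -((N : ℂ) * (-z / N)) = z by field_simp]
  have hv := Matrix.eq_zero_of_forall_pow_sum_mul_pow_eq_zero hinj
    (v := fun j => c j * thetaRow N τ j (-z / N)) fun k => by
      rw [← h (-z / N - (k : ℕ) / N)]
      exact Finset.sum_congr rfl fun j _ => by rw [hshift, mul_assoc]
  exact (mul_eq_zero.1 (congrFun hv i)).resolve_right hz'

/-! ### Products of theta functions -/

lemma prod_neg_e (s : Finset (Fin N)) (y : Fin N → ℂ) :
    ∏ k ∈ s, -e (y k) = (-1) ^ s.card * e (∑ k ∈ s, y k) := by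
  classical
  induction s using Finset.induction_on with
  | empty => simp
  | insert i s hi ih =>
    rw [Finset.prod_insert hi, Finset.sum_insert hi, Finset.card_insert_of_notMem hi, ih, e_add]
    ring

lemma quasiPeriodic_prod_vartheta (hτ : 0 < τ.im) (y : Fin N → ℂ) :
    QuasiPeriodic τ N ((-1) ^ N) ((-1) ^ N * e (∑ k, y k - N * τ / 2))
      fun z => ∏ k, vartheta (z - y k) τ := by
  have := QuasiPeriodic.prod Finset.univ fun k _ => quasiPeriodic_vartheta_sub hτ (y k)
  rw [prod_neg_e] at this
  simpa [Finset.sum_sub_distrib, mul_div_assoc] using this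

lemma QuasiPeriodic.exists_eq_prod_mul (hτ : 0 < τ.im) {x : Fin N → ℂ}
    (hx : ∀ j k, j ≠ k → x j - x k ∉ lattice τ) (s : Finset (Fin N)) {d : ℕ} {α β : ℂ}
    {f : ℂ → ℂ} (hα : α ≠ 0) (hβ : β ≠ 0) (hf : QuasiPeriodic τ (d + s.card) α β f)
    (h0 : ∀ k ∈ s, f (x k) = 0) :
    ∃ g, QuasiPeriodic τ d (α * (-1) ^ s.card) (β * ∏ k ∈ s, -e (τ / 2 - x k)) g ∧
      ∀ z, f z = (∏ k ∈ s, vartheta (z - x k) τ) * g z := by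
  classical
  induction s using Finset.induction_on generalizing d with
  | empty => exact ⟨f, by simpa using hf, by simp⟩
  | insert i s hi ih =>
    rw [Finset.card_insert_of_notMem hi, add_comm s.card, ← add_assoc] at hf
    obtain ⟨g, hg, hfg⟩ := ih hf fun k hk => h0 k (by simp [hk])
    have hgi : g (x i) = 0 := by
      have h1 := h0 i (by simp)
      rw [hfg] at h1
      refine (mul_eq_zero.1 h1).resolve_left (Finset.prod_ne_zero_iff.2 fun k hk => ?_)
      exact vartheta_ne_zero hτ (hx i k fun h => hi (h ▸ hk))
    obtain ⟨g', hg', hgg'⟩ := hg.exists_eq_vartheta_mul hτ (by simp [hα])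
      (mul_ne_zero hβ (Finset.prod_ne_zero_iff.2 fun k _ => neg_ne_zero.2 (e_ne_zero _))) hgi
    refine ⟨g', ?_, fun z => by rw [hfg, hgg', Finset.prod_insert hi]; ring⟩
    rw [Finset.card_insert_of_notMem hi, Finset.prod_insert hi]
    convert hg' using 1 <;> ring

lemma QuasiPeriodic.exists_eq_prod_mul_univ (hτ : 0 < τ.im) {x : Fin N → ℂ}
    (hx : ∀ j k, j ≠ k → x j - x k ∉ lattice τ) {f : ℂ → ℂ}
    (hf : QuasiPeriodic τ N ((-1) ^ N) ((-1) ^ N * e (-(N * τ / 2))) f)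
    (h0 : ∀ k, f (x k) = 0) :
    ∃ g, QuasiPeriodic τ 0 1 (e (-∑ k, x k)) g ∧
      ∀ z, f z = (∏ k, vartheta (z - x k) τ) * g z := by
  have hN2 : ((-1 : ℂ)) ^ N * (-1) ^ N = 1 := by rw [← mul_pow]; simp
  obtain ⟨g, hg, hfg⟩ := QuasiPeriodic.exists_eq_prod_mul hτ hx Finset.univ (d := 0)
    (pow_ne_zero N (by norm_num : (-1 : ℂ) ≠ 0))
    (mul_ne_zero (pow_ne_zero N (by norm_num : (-1 : ℂ) ≠ 0)) (e_ne_zero (-(N * τ / 2))))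
    (by simpa using hf) fun k _ => h0 k
  refine ⟨g, ?_, hfg⟩
  have h1 : (-1) ^ N * e (-(N * τ / 2)) * ∏ k, -e (τ / 2 - x k) = e (-∑ k, x k) := by
    rw [prod_neg_e, Finset.card_univ, Fintype.card_fin, mul_mul_mul_comm, hN2, one_mul, ← e_add]
    simp only [Finset.sum_sub_distrib, Finset.sum_const, Finset.card_univ, Fintype.card_fin,
      nsmul_eq_mul]
    congr 1; ring
  rwa [h1, Finset.card_univ, Fintype.card_fin, hN2] at hg

lemma QuasiPeriodic.eq_zero_of_vanish (hτ : 0 < τ.im) {x : Fin N → ℂ}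
    (hx : ∀ j k, j ≠ k → x j - x k ∉ lattice τ) (hs : ∑ k, x k ∉ lattice τ) {f : ℂ → ℂ}
    (hf : QuasiPeriodic τ N ((-1) ^ N) ((-1) ^ N * e (-(N * τ / 2))) f)
    (h0 : ∀ k, f (x k) = 0) (z : ℂ) : f z = 0 := by
  obtain ⟨g, hg, hfg⟩ := hf.exists_eq_prod_mul_univ hτ hx h0
  rw [hfg, hg.eq_zero_of_notMem_lattice hτ (by rwa [neg_mem_lattice_iff]), mul_zero]

/-! ### The kernel vector -/

lemma kerVec_mul_prod (u : Fin N → ℂ) (l : Fin N) :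
    kerVec N τ u l * ∏ k ∈ Finset.univ.erase l, vartheta (u l - u k) τ =
      (-1) ^ N * ∏ p : Fin N × Fin N with p.1 < p.2, vartheta (u p.2 - u p.1) τ := by
  have h1 : ∀ k ∈ Finset.univ.erase l, vartheta (u l - u k) τ = (if k < l then 1 else -1) *
      (if k < l then vartheta (u l - u k) τ else vartheta (u k - u l) τ) := by
    intro k _
    split_ifs
    · ring
    · rw [← neg_sub, vartheta_neg]; ring
  have h2 : ∏ k ∈ Finset.univ.erase l, (if k < l then 1 else -1 : ℂ) = (-1) ^ (N - 1 - l) := by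
    rw [Finset.prod_ite, Finset.prod_const_one, one_mul, Finset.prod_const, ← Fin.card_Ioi]
    congr 2
    ext k
    simp only [Finset.mem_filter, Finset.mem_erase, Finset.mem_univ, and_true, not_lt,
      Finset.mem_Ioi]
    exact ⟨fun h => lt_of_le_of_ne h.2 (Ne.symm h.1), fun h => ⟨h.ne', h.le⟩⟩
  have h3 : ∏ k ∈ Finset.univ.erase l,
      (if k < l then vartheta (u l - u k) τ else vartheta (u k - u l) τ) =
      ∏ p : Fin N × Fin N with p.1 < p.2 ∧ ¬ (p.1 ≠ l ∧ p.2 ≠ l),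
        vartheta (u p.2 - u p.1) τ := by
    refine Finset.prod_bij (fun k _ => if k < l then (k, l) else (l, k)) ?_ ?_ ?_ ?_
    · intro k hk
      have hk' : k ≠ l := by simpa using hk
      split_ifs with h
      · simp [h]
      · simpa using lt_of_le_of_ne (not_lt.1 h) hk'.symm
    · intro k hk k' hk' h
      have h1 : k ≠ l := by simpa using hk
      have h2 : k' ≠ l := by simpa using hk'
      split_ifs at h <;> simp_all
    · rintro ⟨j, k⟩ h
      simp only [Finset.mem_filter, Finset.mem_univ, true_and, not_and_or, not_not] at h
      obtain ⟨hjk, rfl | rfl⟩ := h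
      · exact ⟨k, by simp [hjk.ne'], by simp [hjk.le]⟩
      · exact ⟨j, by simp [hjk.ne], by simp [hjk]⟩
    · intro k _
      split_ifs <;> rfl
  have h4 := Finset.prod_filter_mul_prod_filter_not
    (Finset.univ.filter fun p : Fin N × Fin N => p.1 < p.2) (fun p => p.1 ≠ l ∧ p.2 ≠ l)
    fun p => vartheta (u p.2 - u p.1) τ
  rw [Finset.filter_filter, Finset.filter_filter] at h4
  rw [Finset.prod_congr rfl h1, Finset.prod_mul_distrib, h2, h3, ← h4, kerVec,
    show ((-1 : ℂ)) ^ N = (-1) ^ ((l : ℕ) + 1) * (-1) ^ (N - 1 - l) by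
      rw [← pow_add]; congr 1; have := l.2; lia]
  ring

lemma kerVec_ne_zero (hτ : 0 < τ.im) {u : Fin N → ℂ}
    (hu : ∀ j k, j ≠ k → u j - u k ∉ lattice τ) (l : Fin N) : kerVec N τ u l ≠ 0 := by
  refine mul_ne_zero (by simp) (Finset.prod_ne_zero_iff.2 fun p hp => ?_)
  simp only [Finset.mem_filter, Finset.mem_univ, true_and] at hp
  exact vartheta_ne_zero hτ (hu _ _ hp.1.ne')

lemma lagrange_of_notMem (hτ : 0 < τ.im) {x : Fin N → ℂ}
    (hx : ∀ j k, j ≠ k → x j - x k ∉ lattice τ) (hs : ∑ k, x k ∉ lattice τ) {f : ℂ → ℂ}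
    (hf : QuasiPeriodic τ N ((-1) ^ N) ((-1) ^ N * e (-(N * τ / 2))) f) (z : ℂ) :
    ((-1) ^ N * ∏ p : Fin N × Fin N with p.1 < p.2, vartheta (x p.2 - x p.1) τ) *
        vartheta (∑ k, x k) τ * f z =
      ∑ l, kerVec N τ x l * f (x l) *
        ∏ k, vartheta (z - Function.update x l (x l - ∑ k, x k) k) τ := by
  set s := ∑ k, x k
  set D := (-1) ^ N * ∏ p : Fin N × Fin N with p.1 < p.2, vartheta (x p.2 - x p.1) τ
  have hQ : ∀ l : Fin N, QuasiPeriodic τ N ((-1) ^ N) ((-1) ^ N * e (-(N * τ / 2)))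
      fun z => ∏ k, vartheta (z - Function.update x l (x l - s) k) τ := by
    intro l
    have h1 : ∑ k, Function.update x l (x l - s) k = 0 := by
      rw [Finset.sum_update_of_mem (Finset.mem_univ l), ← Finset.erase_eq,
        sub_add_eq_add_sub, Finset.add_sum_erase _ _ (Finset.mem_univ l), sub_self]
    have := quasiPeriodic_prod_vartheta hτ (Function.update x l (x l - s))
    rwa [h1, zero_sub] at this
  have hQs := (hf.const_mul (D * vartheta s τ)).add
    ((QuasiPeriodic.sum Finset.univ fun l _ => (hQ l).const_mul
      (kerVec N τ x l * f (x l))).const_mul (-1))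
  have h0 := hQs.eq_zero_of_vanish hτ hx hs (fun m => ?_) z
  · linear_combination h0
  · rw [Finset.sum_eq_single m]
    · rw [← Finset.mul_prod_erase _ _ (Finset.mem_univ m), Function.update_self, sub_sub_cancel]
      have : ∏ k ∈ Finset.univ.erase m, vartheta (x m - Function.update x m (x m - s) k) τ =
          ∏ k ∈ Finset.univ.erase m, vartheta (x m - x k) τ :=
        Finset.prod_congr rfl fun k hk => by
          rw [Function.update_of_ne (by simpa using hk)]
      rw [this]
      linear_combination -(f (x m) * vartheta s τ) * kerVec_mul_prod (τ := τ) x m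
    · intro l _ hl
      rw [Finset.prod_eq_zero (Finset.mem_univ m), mul_zero]
      rw [Function.update_of_ne hl.symm, sub_self, vartheta_zero]
    · simp

lemma continuous_vartheta (hτ : 0 < τ.im) : Continuous fun z => vartheta z τ :=
  (quasiPeriodic_vartheta hτ).differentiable.continuous

lemma continuous_kerVec (hτ : 0 < τ.im) {y : ℂ → Fin N → ℂ} (hy : Continuous y) (l : Fin N) :
    Continuous fun t => kerVec N τ (y t) l :=
  continuous_const.mul (continuous_finsetProd _ fun _ _ =>
    (continuous_vartheta hτ).comp (by fun_prop))

lemma lagrange (hN : N ≠ 0) (hτ : 0 < τ.im) (x : Fin N → ℂ) {f : ℂ → ℂ}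
    (hf : QuasiPeriodic τ N ((-1) ^ N) ((-1) ^ N * e (-(N * τ / 2))) f) (z : ℂ) :
    ((-1) ^ N * ∏ p : Fin N × Fin N with p.1 < p.2, vartheta (x p.2 - x p.1) τ) *
        vartheta (∑ k, x k) τ * f z =
      ∑ l, kerVec N τ x l * f (x l) *
        ∏ k, vartheta (z - Function.update x l (x l - ∑ k, x k) k) τ := by
  set y : ℂ → Fin N → ℂ := fun t k => x k + t * ((k : ℕ) + 1)
  have hy : Continuous y := by fun_prop
  have hv := continuous_vartheta hτ
  have hfc := hf.differentiable.continuous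
  have hd1 := dense_affine_notMem_lattice τ
    (ι := Option {p : Fin N × Fin N // p.1 ≠ p.2})
    (fun o => o.elim (∑ k : Fin N, (((k : ℕ) : ℂ) + 1)) fun p => ((p.1.1 : ℕ) : ℂ) - (p.1.2 : ℕ))
    (fun o => o.elim (∑ k, x k) fun p => x p.1.1 - x p.1.2) (by
      rintro (_ | ⟨p, hp⟩)
      · have : (0 : ℕ) < ∑ k : Fin N, ((k : ℕ) + 1) :=
          Finset.sum_pos (fun _ _ => by lia) ⟨⟨0, Nat.pos_of_ne_zero hN⟩, by simp⟩
        simp only [Option.elim]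
        exact_mod_cast this.ne'
      · simp only [Option.elim, sub_ne_zero]
        exact_mod_cast fun h => hp (Fin.ext h))
  have key := Continuous.ext_on hd1 (f := fun t =>
    ((-1) ^ N * ∏ p : Fin N × Fin N with p.1 < p.2, vartheta (y t p.2 - y t p.1) τ) *
        vartheta (∑ k, y t k) τ * f z) (g := fun t => ∑ l, kerVec N τ (y t) l * f (y t l) *
        ∏ k, vartheta (z - Function.update (y t) l (y t l - ∑ k, y t k) k) τ) ?_ ?_ ?_
  · simpa [y] using congrFun key 0
  · refine Continuous.mul (Continuous.mul (continuous_const.mul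
      (continuous_finsetProd _ fun p _ => hv.comp (by fun_prop))) (hv.comp (by fun_prop)))
      continuous_const
  · refine continuous_finsetSum _ fun l _ => Continuous.mul ((continuous_kerVec hτ hy l).mul
      (hfc.comp (by fun_prop))) (continuous_finsetProd _ fun k _ => hv.comp ?_)
    refine continuous_const.sub ?_
    by_cases hkl : k = l
    · subst hkl; simp only [Function.update_self]; fun_prop
    · simp only [Function.update_of_ne hkl]; fun_prop
  · intro t ht
    refine lagrange_of_notMem hτ (fun j k hjk => ?_) ?_ hf z
    · have := ht (some ⟨(j, k), hjk⟩)
      simp only [Option.elim] at this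
      convert this using 1
      simp only [y]; ring_nf
    · have := ht none
      simp only [Option.elim] at this
      convert this using 1
      simp only [y, Finset.sum_add_distrib, ← Finset.mul_sum]; ring_nf

lemma sum_kerVec_mul_eq_zero (hN : N ≠ 0) (hτ : 0 < τ.im) {u : Fin N → ℂ} (hu : ∑ k, u k = 0)
    {f : ℂ → ℂ} (hf : QuasiPeriodic τ N ((-1) ^ N) ((-1) ^ N * e (-(N * τ / 2))) f) :
    ∑ l, f (u l) * kerVec N τ u l = 0 := by
  obtain ⟨z, hz⟩ := (dense_affine_notMem_lattice τ (fun _ : Fin N => 1) (fun k => -u k)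
    (by simp)).nonempty
  have h := lagrange hN hτ u hf z
  simp only [hu, vartheta_zero, mul_zero, zero_mul, sub_zero, Function.update_eq_self,
    ← Finset.sum_mul] at h
  have h1 := (mul_eq_zero.1 h.symm).resolve_right (Finset.prod_ne_zero_iff.2 fun k _ =>
    vartheta_ne_zero hτ (by simpa [sub_eq_add_neg] using hz k))
  rw [← h1]
  exact Finset.sum_congr rfl fun l _ => mul_comm _ _

lemma XiTilde_zero_mulVec_kerVec (hN : N ≠ 0) (hτ : 0 < τ.im) {u : Fin N → ℂ}
    (hu : ∑ k, u k = 0) : XiTilde N τ u 0 *ᵥ kerVec N τ u = 0 := by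
  funext i
  simp only [Matrix.mulVec, dotProduct, XiTilde_apply hN, zero_div, sub_zero, Pi.zero_apply]
  exact sum_kerVec_mul_eq_zero hN hτ hu (quasiPeriodic_thetaRow hN hτ i)

/-! ### The multipliers of `XiTilde` -/

lemma val_add_one [NeZero N] (i : Fin N) : ((i + 1 : Fin N) : ℕ) = ((i : ℕ) + 1) % N := by
  rw [Fin.val_add, Fin.val_one', Nat.add_mod_mod]

lemma Lam_apply [NeZero N] (i k : Fin N) : Lam N i k = if k = i + 1 then 1 else 0 := by
  simp only [Lam, Matrix.of_apply, Fin.ext_iff, val_add_one]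

lemma Lam_mul_apply [NeZero N] (A : Matrix (Fin N) (Fin N) ℂ) (i j : Fin N) :
    (Lam N * A) i j = A (i + 1) j := by
  simp [Matrix.mul_apply, Lam_apply]

lemma mul_Lam_apply [NeZero N] (A : Matrix (Fin N) (Fin N) ℂ) (i j : Fin N) :
    (A * Lam N) i (j + 1) = A i j := by
  simp [Matrix.mul_apply, Lam_apply]

lemma norm_det_Lam [NeZero N] : ‖(Lam N).det‖ = 1 := by
  have h : Lam N = (Equiv.addRight (1 : Fin N)).permMatrix ℂ := by
    ext i k
    simp [Lam_apply, Equiv.Perm.permMatrix, PEquiv.toMatrix_apply, eq_comm]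
  rw [h, Matrix.det_permutation]
  rcases Int.units_eq_one_or (Equiv.Perm.sign (Equiv.addRight (1 : Fin N))) with h | h <;> simp [h]

lemma norm_det_Q : ‖(Q N).det‖ = 1 := by
  rw [Q, Matrix.det_diagonal, norm_prod]
  refine Finset.prod_eq_one fun k _ => ?_
  have : (((k : ℕ) : ℂ) + 1) / N = ((((k : ℕ) + 1) / N : ℝ) : ℂ) := by push_cast; rfl
  rw [this, norm_e_ofReal]

lemma XiTilde_add_one (u : Fin N → ℂ) (z : ℂ) :
    XiTilde N τ u (z + 1) = -(Q N * XiTilde N τ u z) := by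
  ext i j
  simp only [XiTilde, Q, Matrix.neg_apply, Matrix.diagonal_mul, Matrix.of_apply]
  rw [add_sub_right_comm, thetaChar_add_one, e_sub, e_half]
  ring

lemma XiTilde_add_tau [NeZero N] (u : Fin N → ℂ) (z : ℂ) :
    XiTilde N τ u (z + τ) =
      LamTilde N τ z * XiTilde N τ u z * Matrix.diagonal fun j => e (u j) := by
  have hN : (N : ℂ) ≠ 0 := Nat.cast_ne_zero.2 (NeZero.ne N)
  ext i j
  rw [Matrix.mul_diagonal, LamTilde, Matrix.smul_mul, Matrix.smul_apply, Lam_mul_apply]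
  simp only [XiTilde, Matrix.of_apply, smul_eq_mul]
  have h : thetaChar ((((i : ℕ) : ℂ) + 1) / N - 1 / 2 + 1 / N) (N / 2) (z - N * u j) (N * τ) =
      thetaChar ((((i + 1 : Fin N) : ℕ) + 1) / N - 1 / 2) (N / 2) (z - N * u j) (N * τ) := by
    rw [val_add_one]
    rcases Nat.lt_or_ge ((i : ℕ) + 1) N with h | h
    · rw [Nat.mod_eq_of_lt h]; congr 1; push_cast; ring
    · have h1 : (i : ℕ) + 1 = N := le_antisymm i.2 h
      rw [h1, Nat.mod_self, ← thetaChar_char_add_one (((0 : ℕ) + 1) / N - 1 / 2)]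
      have : ((i : ℕ) : ℂ) + 1 = N := by exact_mod_cast h1
      rw [this]
      congr 1; push_cast; field_simp; ring
  rw [show z + τ - N * u j = z - N * u j + (1 / N) * (N * τ) by field_simp; ring,
    thetaChar_add_mul, h, show -((1 / (N : ℂ)) ^ 2 * (N * τ) / 2) -
      1 / N * (z - N * u j + N / 2) = (-τ / (2 * N) - z / N) + u j + -(1 / 2) by
        field_simp; ring, e_add, e_add, e_neg (1 / 2), e_half]
  norm_num
  ring

lemma differentiable_XiTilde (hN : N ≠ 0) (hτ : 0 < τ.im) (u : Fin N → ℂ) (i j : Fin N) :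
    Differentiable ℂ fun z => XiTilde N τ u z i j := by
  simp only [XiTilde_apply hN]
  exact (quasiPeriodic_thetaRow hN hτ i).differentiable.comp (by fun_prop)

lemma differentiable_matrix_det {X : ℂ → Matrix (Fin N) (Fin N) ℂ}
    (hX : ∀ i j, Differentiable ℂ fun z => X z i j) : Differentiable ℂ fun z => (X z).det := by
  simp only [Matrix.det_apply]
  refine Differentiable.fun_sum fun σ _ => Differentiable.const_smul ?_ _
  exact Differentiable.fun_finsetProd fun i _ => hX _ _

/-! ### The determinant and the kernel of `XiTilde` -/

lemma quasiPeriodic_sum_thetaRow (hN : N ≠ 0) (hτ : 0 < τ.im) (c : Fin N → ℂ) :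
    QuasiPeriodic τ N ((-1) ^ N) ((-1) ^ N * e (-(N * τ / 2)))
      fun x => ∑ i, c i * thetaRow N τ i x :=
  QuasiPeriodic.sum Finset.univ fun i _ => (quasiPeriodic_thetaRow hN hτ i).const_mul (c i)

lemma det_XiTilde_ne_zero (hN : N ≠ 0) (hτ : 0 < τ.im) {u : Fin N → ℂ} (hu : ∑ j, u j = 0)
    (hd : ∀ j k, j ≠ k → u j - u k ∉ lattice τ) {z : ℂ} (hz : z ∉ lattice τ) :
    (XiTilde N τ u z).det ≠ 0 := by
  have hN' : (N : ℂ) ≠ 0 := Nat.cast_ne_zero.2 hN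
  intro h0
  obtain ⟨c, hc, hcM⟩ := Matrix.exists_vecMul_eq_zero_iff.2 h0
  refine hc (thetaRow_linearIndependent hN hτ ((quasiPeriodic_sum_thetaRow hN hτ
    c).eq_zero_of_vanish hτ (x := fun j => u j - z / N) ?_ ?_ fun k => ?_))
  · simpa using hd
  · simp only [Finset.sum_sub_distrib, hu, Finset.sum_const, Finset.card_univ, Fintype.card_fin,
      nsmul_eq_mul, mul_div_cancel₀ _ hN', zero_sub]
    rwa [neg_mem_lattice_iff]
  · have := congrFun hcM k
    simpa only [Matrix.vecMul, dotProduct, XiTilde_apply hN] using! this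

lemma exists_det_XiTilde_eq [NeZero N] (hτ : 0 < τ.im) {u : Fin N → ℂ} (hu : ∑ j, u j = 0)
    (hd : ∀ j k, j ≠ k → u j - u k ∉ lattice τ) :
    ∃ c : ℂ, c ≠ 0 ∧ ∀ z, (XiTilde N τ u z).det = c * vartheta z τ := by
  have hN := NeZero.ne N
  have hN' : (N : ℂ) ≠ 0 := Nat.cast_ne_zero.2 hN
  have hw : kerVec N τ u ≠ 0 := fun h =>
    kerVec_ne_zero hτ hd ⟨0, Nat.pos_of_ne_zero hN⟩ (congrFun h _)
  have h0 : (XiTilde N τ u 0).det = 0 :=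
    Matrix.exists_mulVec_eq_zero_iff.1 ⟨_, hw, XiTilde_zero_mulVec_kerVec hN hτ hu⟩
  have hQ : QuasiPeriodic τ (0 + 1) ((-1) ^ N * (Q N).det)
      ((-1) ^ N * (Lam N).det * e (-(τ / 2))) fun z => (XiTilde N τ u z).det := by
    refine ⟨differentiable_matrix_det (differentiable_XiTilde hN hτ u), fun z => ?_, fun z => ?_⟩
    · rw [XiTilde_add_one, Matrix.det_neg, Matrix.det_mul, Fintype.card_fin, mul_assoc]
    · have h1 : ∏ j, e (u j) = 1 := by
        have h2 := prod_neg_e Finset.univ u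
        rw [hu, e_zero, Finset.prod_neg, mul_one] at h2
        exact mul_left_cancel₀ (pow_ne_zero _ (by norm_num : (-1 : ℂ) ≠ 0))
          (h2.trans (mul_one _).symm)
      rw [XiTilde_add_tau, Matrix.det_mul, Matrix.det_mul, LamTilde, Matrix.det_smul,
        Matrix.det_diagonal, h1, Fintype.card_fin, neg_pow, ← e_nat_mul,
        show (N : ℂ) * (-τ / (2 * N) - z / N) = -(τ / 2) + -((0 + 1 : ℕ) * z) by
          push_cast; field_simp; ring, e_add]
      ring
  have hα : ‖(-1) ^ N * (Q N).det‖ = 1 := by simp [norm_det_Q]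
  have hβ : ‖(-1) ^ N * (Lam N).det‖ = 1 := by simp [norm_det_Lam]
  obtain ⟨g, hg, hfg⟩ := hQ.exists_eq_vartheta_mul hτ (c := 0)
    (by rw [← norm_ne_zero_iff, hα]; exact one_ne_zero)
    (mul_ne_zero (by rw [← norm_ne_zero_iff, hβ]; exact one_ne_zero) (e_ne_zero _)) h0
  have hc := hg.apply_eq_apply hτ (by rw [norm_neg, hα]) (by
    rw [neg_mul, mul_assoc, ← e_add, sub_zero, neg_add_cancel, e_zero, mul_one, norm_neg, hβ])
  have heq : ∀ z, (XiTilde N τ u z).det = g 0 * vartheta z τ := fun z => by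
    rw [hfg, hc z 0, sub_zero, mul_comm]
  refine ⟨g 0, fun h => ?_, heq⟩
  obtain ⟨z, hz⟩ := (dense_compl_lattice τ).nonempty
  exact det_XiTilde_ne_zero hN hτ hu hd hz (by rw [heq, h, zero_mul])

lemma det_XiTilde_zero (hN : N ≠ 0) (hτ : 0 < τ.im) {u : Fin N → ℂ} (hu : ∑ j, u j = 0) :
    (XiTilde N τ u 0).det = 0 := by
  set y : ℂ → Fin N → ℂ := fun t k => u k + t * (N * ((k : ℕ) : ℂ) - ∑ l : Fin N, ((l : ℕ) : ℂ))
  have hN' : (N : ℂ) ≠ 0 := Nat.cast_ne_zero.2 hN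
  have hy : ∀ t, ∑ k, y t k = 0 := by
    intro t
    simp only [y, Finset.sum_add_distrib, hu, ← Finset.mul_sum, Finset.sum_sub_distrib,
      Finset.sum_const, Finset.card_univ, Fintype.card_fin, nsmul_eq_mul]
    ring
  have hdense := dense_affine_notMem_lattice τ (ι := {p : Fin N × Fin N // p.1 ≠ p.2})
    (fun p => N * (((p.1.1 : ℕ) : ℂ) - (p.1.2 : ℕ))) (fun p => u p.1.1 - u p.1.2) fun p =>
      mul_ne_zero hN' (sub_ne_zero.2 (by exact_mod_cast fun h => p.2 (Fin.ext h)))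
  have key := Continuous.ext_on hdense (f := fun t => (XiTilde N τ (y t) 0).det) (g := fun _ => 0)
    (Continuous.matrix_det (continuous_matrix fun i j => ?_)) continuous_const fun t ht => ?_
  · simpa [y] using congrFun key 0
  · simp only [XiTilde_apply hN]
    exact (quasiPeriodic_thetaRow hN hτ i).differentiable.continuous.comp (by fun_prop)
  · have hd : ∀ j k, j ≠ k → y t j - y t k ∉ lattice τ := fun j k hjk => by
      have := ht ⟨(j, k), hjk⟩
      rwa [show y t j - y t k = N * (((j : ℕ) : ℂ) - (k : ℕ)) * t + (u j - u k) by
        simp only [y]; ring]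
    exact Matrix.exists_mulVec_eq_zero_iff.1 ⟨kerVec N τ (y t), fun h =>
      kerVec_ne_zero hτ hd ⟨0, Nat.pos_of_ne_zero hN⟩ (congrFun h _),
      XiTilde_zero_mulVec_kerVec hN hτ (hy t)⟩

lemma finrank_ker_XiTilde_zero_le (hN : N ≠ 0) (hτ : 0 < τ.im) {u : Fin N → ℂ}
    (hu : ∑ j, u j = 0) (hd : ∀ j k, j ≠ k → u j - u k ∉ lattice τ) :
    Module.finrank ℂ (LinearMap.ker (XiTilde N τ u 0).mulVecLin) ≤ 1 := by
  set A := XiTilde N τ u 0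
  obtain ⟨z, hz⟩ := (dense_affine_notMem_lattice τ (fun _ : Fin N => 1) (fun k => -u k)
    (by simp)).nonempty
  have hz' : ∏ k, vartheta (z - u k) τ ≠ 0 := Finset.prod_ne_zero_iff.2 fun k _ =>
    vartheta_ne_zero hτ (by simpa [sub_eq_add_neg] using hz k)
  have hT : Module.finrank ℂ (LinearMap.ker Aᵀ.mulVecLin) ≤ 1 := by
    rw [← Module.finrank_self ℂ]
    refine LinearMap.finrank_le_finrank_of_injective
      (f := (dotProductBilin ℂ ℂ (fun i => thetaRow N τ i z)).comp
        (LinearMap.ker Aᵀ.mulVecLin).subtype) ?_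
    rw [← LinearMap.ker_eq_bot, LinearMap.ker_eq_bot']
    rintro ⟨c, hc⟩ hcz
    refine Subtype.ext (thetaRow_linearIndependent hN hτ fun x => ?_)
    have hcz' : ∑ i, c i * thetaRow N τ i z = 0 := by
      rw [← hcz]
      exact Finset.sum_congr rfl fun i _ => mul_comm _ _
    obtain ⟨g, hg, hfg⟩ := (quasiPeriodic_sum_thetaRow hN hτ c).exists_eq_prod_mul_univ hτ hd
      fun k => by
        have := congrFun (LinearMap.mem_ker.1 hc) k
        rw [Matrix.mulVecLin_apply, Matrix.mulVec_transpose] at this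
        simpa [Matrix.vecMul, dotProduct, A, XiTilde_apply hN] using this
    have hgz : g z = 0 := by
      have := hfg z
      simp only [hcz'] at this
      exact (mul_eq_zero.1 this.symm).resolve_left hz'
    have := hfg x
    rw [hg.apply_eq_apply hτ (by simp) (by simp [hu]) x z, hgz, mul_zero] at this
    exact this
  have h1 := LinearMap.finrank_range_add_finrank_ker A.mulVecLin
  have h2 := LinearMap.finrank_range_add_finrank_ker Aᵀ.mulVecLin
  have h3 := Matrix.rank_transpose A
  rw [Matrix.rank, Matrix.rank] at h3
  lia

lemma ker_XiTilde_zero (hN : N ≠ 0) (hτ : 0 < τ.im) {u : Fin N → ℂ}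
    (hu : ∑ j, u j = 0) (hd : ∀ j k, j ≠ k → u j - u k ∉ lattice τ) :
    kerVec N τ u ≠ 0 ∧
      LinearMap.ker (XiTilde N τ u 0).mulVecLin = Submodule.span ℂ {kerVec N τ u} := by
  have hw : kerVec N τ u ≠ 0 := fun h =>
    kerVec_ne_zero hτ hd ⟨0, Nat.pos_of_ne_zero hN⟩ (congrFun h _)
  refine ⟨hw, (Submodule.eq_of_le_of_finrank_le ?_ ?_).symm⟩
  · rw [Submodule.span_singleton_le_iff_mem]
    exact XiTilde_zero_mulVec_kerVec hN hτ hu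
  · rw [finrank_span_singleton hw]
    exact finrank_ker_XiTilde_zero_le hN hτ hu hd

/-! ### The gauge transformation `Xi` -/

lemma Xi_add_one (u : Fin N → ℂ) (z : ℂ) : Xi N τ u (z + 1) = -(Q N * Xi N τ u z) := by
  rw [Xi, XiTilde_add_one, Xi, Matrix.neg_mul, Matrix.mul_assoc]

lemma Xi_add_tau [NeZero N] (u : Fin N → ℂ) (z : ℂ) :
    Xi N τ u (z + τ) = LamTilde N τ z * Xi N τ u z * Matrix.diagonal fun j => e (u j) := by
  rw [Xi, XiTilde_add_tau, Xi, Matrix.mul_assoc, Matrix.diagonal_mul_diagonal, Matrix.mul_assoc,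
    Matrix.mul_assoc, Matrix.mul_assoc, Matrix.diagonal_mul_diagonal]
  simp only [mul_comm]

lemma differentiable_Xi (hN : N ≠ 0) (hτ : 0 < τ.im) (u : Fin N → ℂ) (i j : Fin N) :
    Differentiable ℂ fun z => Xi N τ u z i j := by
  simp only [Xi, Matrix.mul_diagonal]
  exact (differentiable_XiTilde hN hτ u i j).mul_const _

lemma exists_det_Xi_eq [NeZero N] (hτ : 0 < τ.im) {u : Fin N → ℂ} (hu : ∑ j, u j = 0)
    (hd : ∀ j k, j ≠ k → u j - u k ∉ lattice τ) :
    ∃ c : ℂ, c ≠ 0 ∧ ∀ z, (Xi N τ u z).det = c * vartheta z τ := by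
  obtain ⟨c, hc, h⟩ := exists_det_XiTilde_eq hτ hu hd
  refine ⟨c * ∏ l, kerVec N τ u l, mul_ne_zero hc (Finset.prod_ne_zero_iff.2 fun l _ =>
    kerVec_ne_zero hτ hd l), fun z => ?_⟩
  rw [Xi, Matrix.det_mul, Matrix.det_diagonal, h]; ring

lemma analyticOrderAt_const_mul_vartheta (hτ : 0 < τ.im) {c : ℂ} (hc : c ≠ 0) :
    analyticOrderAt (fun z => c * vartheta z τ) 0 = 1 := by
  have hth := (quasiPeriodic_vartheta hτ).differentiable
  have ha : AnalyticAt ℂ (fun z => c * vartheta z τ) 0 := (hth.const_mul c).analyticAt 0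
  refine AnalyticAt.analyticOrderAt_eq_one_of_zero_deriv_ne_zero ha (by simp [vartheta_zero]) ?_
  rw [deriv_const_mul _ (hth 0)]
  exact mul_ne_zero hc (deriv_vartheta_zero hτ)

lemma ker_Xi_zero (hN : N ≠ 0) (hτ : 0 < τ.im) {u : Fin N → ℂ}
    (hu : ∑ j, u j = 0) (hd : ∀ j k, j ≠ k → u j - u k ∉ lattice τ) :
    LinearMap.ker (Xi N τ u 0).mulVecLin = Submodule.span ℂ {fun _ => (1 : ℂ)} := by
  ext y
  have h1 : y ∈ LinearMap.ker (Xi N τ u 0).mulVecLin ↔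
      Matrix.diagonal (kerVec N τ u) *ᵥ y ∈ LinearMap.ker (XiTilde N τ u 0).mulVecLin := by
    simp [Xi, Matrix.mulVec_mulVec]
  rw [h1, (ker_XiTilde_zero hN hτ hu hd).2, Submodule.mem_span_singleton,
    Submodule.mem_span_singleton]
  refine exists_congr fun a => ?_
  simp only [funext_iff, Matrix.mulVec_diagonal, Pi.smul_apply, smul_eq_mul, mul_one]
  refine forall_congr' fun l => ?_
  rw [mul_comm]
  exact mul_right_inj' (kerVec_ne_zero hτ hd l)

/-! ### Expansion in the sin-algebra basis -/

lemma e_mul_val_add_div (m : ℕ) (k l : Fin N) :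
    e ((m : ℂ) * ((k + l : Fin N) : ℕ) / N) =
      e ((m : ℂ) * (k : ℕ) / N) * e ((m : ℂ) * (l : ℕ) / N) := by
  have hN : (N : ℂ) ≠ 0 := Nat.cast_ne_zero.2 (by have := k.2; lia)
  have h : (((k + l : Fin N) : ℕ) : ℂ) + N * (((k : ℕ) + l) / N : ℕ) = (k : ℕ) + (l : ℕ) := by
    rw [Fin.val_add]
    exact_mod_cast Nat.mod_add_div _ _
  rw [← e_add, ← add_div, ← mul_add, ← h, mul_add, add_div, e_add, mul_left_comm _ (N : ℂ),
    mul_div_cancel_left₀ _ hN, ← Nat.cast_mul m (_ / N), e_nat, mul_one]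

lemma e_val_add_div (k l : Fin N) :
    e ((((k + l : Fin N) : ℕ) : ℂ) / N) = e (((k : ℕ) : ℂ) / N) * e (((l : ℕ) : ℂ) / N) := by
  simpa using e_mul_val_add_div 1 k l

lemma e_mul_val_add_one_div [NeZero N] (m : ℕ) (k : Fin N) :
    e ((m : ℂ) * ((k + 1 : Fin N) : ℕ) / N) = e ((m : ℂ) * ((k : ℕ) + 1) / N) := by
  have hN : (N : ℂ) ≠ 0 := Nat.cast_ne_zero.2 (NeZero.ne N)
  have h : (((k + 1 : Fin N) : ℕ) : ℂ) + N * (((k : ℕ) + 1) / N : ℕ) = (k : ℕ) + 1 := by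
    rw [val_add_one]
    exact_mod_cast Nat.mod_add_div _ _
  rw [← h, mul_add, add_div, e_add, mul_left_comm, mul_div_cancel_left₀ _ hN,
    ← Nat.cast_mul m (_ / N), e_nat, mul_one]

lemma Lam_pow_apply [NeZero N] (n : ℕ) (i k : Fin N) :
    (Lam N ^ n) i k = if k = i + Fin.ofNat N n then 1 else 0 := by
  induction n generalizing i k with
  | zero =>
    simp [Matrix.one_apply, eq_comm]
  | succ n ih =>
    have h : Fin.ofNat N (n + 1) = 1 + Fin.ofNat N n := by
      ext; simp [Fin.val_add, add_comm]
    rw [pow_succ', Lam_mul_apply, ih, h, add_assoc]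

lemma Q_pow_mul_Lam_pow_apply [NeZero N] (m n i j : Fin N) :
    (Q N ^ (m : ℕ) * Lam N ^ (n : ℕ)) i j =
      if j = i + n then e (((m : ℕ) : ℂ) * ((i : ℕ) + 1) / N) else 0 := by
  rw [Q, Matrix.diagonal_pow, Matrix.diagonal_mul, Lam_pow_apply, Fin.ofNat_val_eq_self,
    Pi.pow_apply, ← e_nat_mul, mul_div_assoc]
  simp

/-- The coefficient of a matrix at `e (m n / 2 N) Q ^ m Λ ^ n`. -/
noncomputable def sinCoeff (m n : Fin N) (A : Matrix (Fin N) (Fin N) ℂ) : ℂ :=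
  e (-(((m : ℕ) : ℂ) * (n : ℕ) / (2 * N))) * ((N : ℂ)⁻¹ *
    ∑ k : Fin N, e (-(((m : ℕ) : ℂ) * ((k : ℕ) + 1) / N)) * A k (k + n))

lemma sum_e_mul_div (i k : Fin N) :
    ∑ m : Fin N, e (((m : ℕ) : ℂ) * ((i : ℕ) + 1) / N) * e (-(((m : ℕ) : ℂ) * ((k : ℕ) + 1) / N)) =
      if i = k then (N : ℂ) else 0 := by
  have hN : (N : ℂ) ≠ 0 := Nat.cast_ne_zero.2 (by have := k.2; lia)
  have h : ∀ m : Fin N, e (((m : ℕ) : ℂ) * ((i : ℕ) + 1) / N) *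
      e (-(((m : ℕ) : ℂ) * ((k : ℕ) + 1) / N)) =
      e ((((i : ℕ) : ℂ) - (k : ℕ)) / N) ^ (m : ℕ) := by
    intro m
    rw [← e_add, ← e_nat_mul]
    congr 1; ring
  simp only [h]
  split_ifs with hik
  · simp [hik]
  · rw [Fin.sum_univ_eq_sum_range (fun m => e ((((i : ℕ) : ℂ) - (k : ℕ)) / N) ^ m), geom_sum_eq,
      ← e_nat_mul, mul_div_cancel₀ _ hN, e_sub]
    · simp
    · intro h1
      rw [sub_div, e_sub, div_eq_one_iff_eq (e_ne_zero _)] at h1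
      exact hik (Fin.ext (e_natCast_div_injOn i.2 k.2 h1))

lemma eq_sum_sinCoeff [NeZero N] (A : Matrix (Fin N) (Fin N) ℂ) :
    A = ∑ p : Fin N × Fin N, sinCoeff p.1 p.2 A •
      (e (((p.1 : ℕ) : ℂ) * ((p.2 : ℕ) : ℂ) / (2 * N)) •
        (Q N ^ (p.1 : ℕ) * Lam N ^ (p.2 : ℕ))) := by
  have hN : (N : ℂ) ≠ 0 := Nat.cast_ne_zero.2 (NeZero.ne N)
  ext i j
  have h1 : ∀ m n : Fin N, sinCoeff m n A * (e (((m : ℕ) : ℂ) * ((n : ℕ) : ℂ) / (2 * N)) *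
      (if j = i + n then e (((m : ℕ) : ℂ) * ((i : ℕ) + 1) / N) else 0)) =
      if n = j - i then ∑ k, (N : ℂ)⁻¹ * A k (k + n) * (e (((m : ℕ) : ℂ) * ((i : ℕ) + 1) / N) *
        e (-(((m : ℕ) : ℂ) * ((k : ℕ) + 1) / N))) else 0 := by
    intro m n
    have h2 : j = i + n ↔ n = j - i := by rw [eq_sub_iff_add_eq, add_comm, eq_comm]
    simp only [h2]
    split_ifs
    · rw [sinCoeff, e_neg, Finset.mul_sum, Finset.mul_sum, Finset.sum_mul]
      refine Finset.sum_congr rfl fun k _ => ?_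
      field_simp [e_ne_zero]
    · simp
  simp only [Matrix.sum_apply, Matrix.smul_apply, smul_eq_mul, Q_pow_mul_Lam_pow_apply, h1,
    Fintype.sum_prod_type, Finset.sum_ite_eq', Finset.mem_univ, if_true]
  rw [Finset.sum_comm]
  simp only [← Finset.mul_sum, sum_e_mul_div, mul_ite, mul_zero, Finset.sum_ite_eq,
    Finset.mem_univ, if_true]
  rw [add_sub_cancel]
  field_simp

lemma sinCoeff_smul (m n : Fin N) (c : ℂ) (A : Matrix (Fin N) (Fin N) ℂ) :
    sinCoeff m n (c • A) = c * sinCoeff m n A := by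
  simp only [sinCoeff, Matrix.smul_apply, smul_eq_mul, mul_left_comm _ c, ← Finset.mul_sum]

lemma sinCoeff_of_mul_Q {A B : Matrix (Fin N) (Fin N) ℂ} (h : B * Q N = Q N * A) (m n : Fin N) :
    sinCoeff m n B = e (-(((n : ℕ) : ℂ) / N)) * sinCoeff m n A := by
  have hB : ∀ k, B k (k + n) = e (-(((n : ℕ) : ℂ) / N)) * A k (k + n) := by
    intro k
    have h1 := congrFun (congrFun h k) (k + n)
    rw [Q, Matrix.mul_diagonal, Matrix.diagonal_mul, add_div, add_div, e_add, e_add,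
      e_val_add_div] at h1
    rw [e_neg]
    have h2 := e_ne_zero (((k : ℕ) : ℂ) / N)
    have h3 := e_ne_zero (((n : ℕ) : ℂ) / N)
    have h4 := e_ne_zero (1 / (N : ℂ))
    refine mul_right_cancel₀ (mul_ne_zero (mul_ne_zero h2 h3) h4) (h1.trans ?_)
    field_simp
  simp only [sinCoeff, hB, mul_left_comm _ (e (-(((n : ℕ) : ℂ) / N))), ← Finset.mul_sum]

lemma sinCoeff_of_mul_Lam [NeZero N] {A B : Matrix (Fin N) (Fin N) ℂ}
    (h : B * Lam N = Lam N * A) (m n : Fin N) :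
    sinCoeff m n B = e (((m : ℕ) : ℂ) / N) * sinCoeff m n A := by
  have hB : ∀ i j, B i j = A (i + 1) (j + 1) := fun i j => by
    rw [← mul_Lam_apply B i j, h, Lam_mul_apply]
  have h1 : ∑ k : Fin N, e (-(((m : ℕ) : ℂ) * ((k : ℕ) + 1) / N)) * B k (k + n) =
      e (((m : ℕ) : ℂ) / N) *
        ∑ k : Fin N, e (-(((m : ℕ) : ℂ) * ((k : ℕ) + 1) / N)) * A k (k + n) := by
    rw [Finset.mul_sum, ← Equiv.sum_comp (Equiv.addRight (1 : Fin N))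
      fun k => e (((m : ℕ) : ℂ) / N) * (e (-(((m : ℕ) : ℂ) * ((k : ℕ) + 1) / N)) * A k (k + n))]
    refine Finset.sum_congr rfl fun k _ => ?_
    rw [hB, Equiv.coe_addRight, add_right_comm k n 1, ← mul_assoc, ← e_add,
      show ((m : ℕ) : ℂ) / N + -(((m : ℕ) : ℂ) * (((k + 1 : Fin N) : ℕ) + 1) / N) =
        -(((m : ℕ) : ℂ) * ((k + 1 : Fin N) : ℕ) / N) by ring, e_neg, e_neg,
      e_mul_val_add_one_div]
  rw [sinCoeff, h1, sinCoeff]; ring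

lemma sinCoeff_zero_zero {m n : Fin N} (hm : (m : ℕ) = 0) (hn : (n : ℕ) = 0)
    (A : Matrix (Fin N) (Fin N) ℂ) : sinCoeff m n A = (N : ℂ)⁻¹ * A.trace := by
  have : ∀ k : Fin N, k + n = k := fun k => by
    ext; rw [Fin.val_add, hn, add_zero, Nat.mod_eq_of_lt k.2]
  simp [sinCoeff, hm, this, Matrix.trace]

lemma differentiable_sinCoeff {A : ℂ → Matrix (Fin N) (Fin N) ℂ}
    (hA : ∀ i j, Differentiable ℂ fun z => A z i j) (m n : Fin N) :
    Differentiable ℂ fun z => sinCoeff m n (A z) :=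
  ((Differentiable.fun_sum fun k _ => (hA k (k + n)).const_mul _).const_mul _).const_mul _

/-! ### The Calogero-Moser Lax operator in the new gauge -/

lemma phi_add_one (hτ : 0 < τ.im) (u z : ℂ) : phi τ u (z + 1) = phi τ u z := by
  have h := (quasiPeriodic_vartheta hτ).add_one
  rw [phi, ← add_assoc, h, h, phi]
  rw [mul_assoc, mul_left_comm (vartheta u τ), mul_div_mul_left _ _ (by norm_num)]

lemma phi_add_tau (hτ : 0 < τ.im) (u z : ℂ) : phi τ u (z + τ) = e (-u) * phi τ u z := by
  have h := (quasiPeriodic_vartheta hτ).add_tau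
  have h1 : -e (-(τ / 2)) * e (-((1 : ℕ) * z)) ≠ 0 :=
    mul_ne_zero (neg_ne_zero.2 (e_ne_zero _)) (e_ne_zero _)
  rw [phi, ← add_assoc, h, h, phi, mul_left_comm (vartheta u τ), ← mul_div_assoc (e (-u)),
    ← mul_div_mul_left (e (-u) * _) _ h1]
  congr 1
  rw [show -((1 : ℕ) * (u + z)) = -u + -((1 : ℕ) * z) by push_cast; ring, e_add]
  ring

lemma conj_mul_eq_mul_conj {P X D M M' Y : Matrix (Fin N) (Fin N) ℂ} (hY : Y = P * X * D)
    (hX : IsUnit X.det) (hD : IsUnit D.det) (hYu : IsUnit Y.det) (hM : D * M' = M * D) :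
    (Y * M' * Y⁻¹) * P = P * (X * M * X⁻¹) := by
  have h1 : D * Y⁻¹ * P = X⁻¹ := by
    have h2 : D * Y⁻¹ * P * (X * D) = X⁻¹ * (X * D) := by
      rw [← Matrix.mul_assoc X⁻¹, Matrix.nonsing_inv_mul _ hX, Matrix.one_mul, Matrix.mul_assoc,
        ← Matrix.mul_assoc P, ← hY, Matrix.mul_assoc, Matrix.nonsing_inv_mul _ hYu, Matrix.mul_one]
    have h3 : IsUnit (X * D).det := by rw [Matrix.det_mul]; exact hX.mul hD
    rw [← Matrix.mul_nonsing_inv_cancel_right _ (D * Y⁻¹ * P) h3, h2,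
      Matrix.mul_nonsing_inv_cancel_right _ _ h3]
  calc Y * M' * Y⁻¹ * P = P * X * (D * M') * Y⁻¹ * P := by rw [hY]; simp only [Matrix.mul_assoc]
    _ = P * (X * M * (D * Y⁻¹ * P)) := by rw [hM]; simp only [Matrix.mul_assoc]
    _ = _ := by rw [h1]

/-- The gauge transform of the Calogero-Moser Lax operator. -/
noncomputable def laxGauge (N : ℕ) (τ ν : ℂ) (v u : Fin N → ℂ) (z : ℂ) :
    Matrix (Fin N) (Fin N) ℂ :=
  Xi N τ u z * laxCM N τ ν v u z * (Xi N τ u z)⁻¹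

/-- The numerator of the Calogero-Moser Lax operator. -/
noncomputable def laxCMNum (N : ℕ) (τ ν : ℂ) (v u : Fin N → ℂ) (z : ℂ) :
    Matrix (Fin N) (Fin N) ℂ :=
  Matrix.of fun j k => if j = k then v j * vartheta z τ else
    ν * (vartheta (u j - u k + z) τ * deriv (fun w => vartheta w τ) 0 / vartheta (u j - u k) τ)

lemma laxCMNum_eq (hτ : 0 < τ.im) (ν : ℂ) (v u : Fin N → ℂ) {z : ℂ} (hz : z ∉ lattice τ) :
    laxCMNum N τ ν v u z = vartheta z τ • laxCM N τ ν v u z := by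
  have := vartheta_ne_zero hτ hz
  ext j k
  simp only [laxCMNum, laxCM, Matrix.of_apply, Matrix.smul_apply, smul_eq_mul]
  split_ifs
  · ring
  · rw [phi]; field_simp

lemma differentiable_laxCMNum (hτ : 0 < τ.im) (ν : ℂ) (v u : Fin N → ℂ) (j k : Fin N) :
    Differentiable ℂ fun z => laxCMNum N τ ν v u z j k := by
  have hth := (quasiPeriodic_vartheta hτ).differentiable
  simp only [laxCMNum, Matrix.of_apply]
  split_ifs
  · exact hth.const_mul _
  · exact (((hth.comp (by fun_prop : Differentiable ℂ fun z => u j - u k + z)).mul_const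
      _).div_const _).const_mul _

lemma differentiable_matrix_mul {X Y : ℂ → Matrix (Fin N) (Fin N) ℂ}
    (hX : ∀ i j, Differentiable ℂ fun z => X z i j) (hY : ∀ i j, Differentiable ℂ fun z => Y z i j)
    (i j : Fin N) : Differentiable ℂ fun z => (X z * Y z) i j := by
  simp only [Matrix.mul_apply]
  exact Differentiable.fun_sum fun k _ => (hX i k).mul (hY k j)

lemma differentiable_matrix_adjugate {X : ℂ → Matrix (Fin N) (Fin N) ℂ}
    (hX : ∀ i j, Differentiable ℂ fun z => X z i j) (i j : Fin N) :
    Differentiable ℂ fun z => (X z).adjugate i j := by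
  simp only [Matrix.adjugate_apply]
  refine differentiable_matrix_det fun k l => ?_
  by_cases hk : k = j
  · subst hk; simp only [Matrix.updateRow_self]; fun_prop
  · simp only [Matrix.updateRow_ne hk]; exact hX k l

section

variable {u : Fin N → ℂ} [NeZero N]

lemma isUnit_det_Xi (hτ : 0 < τ.im) (hu : ∑ j, u j = 0)
    (hd : ∀ j k, j ≠ k → u j - u k ∉ lattice τ) {z : ℂ} (hz : z ∉ lattice τ) :
    IsUnit (Xi N τ u z).det := by
  obtain ⟨c, hc, h⟩ := exists_det_Xi_eq hτ hu hd
  rw [h, isUnit_iff_ne_zero]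
  exact mul_ne_zero hc (vartheta_ne_zero hτ hz)

lemma laxGauge_add_one (hτ : 0 < τ.im) (hu : ∑ j, u j = 0)
    (hd : ∀ j k, j ≠ k → u j - u k ∉ lattice τ) (ν : ℂ) (v : Fin N → ℂ) {z : ℂ}
    (hz : z ∉ lattice τ) :
    laxGauge N τ ν v u (z + 1) * Q N = Q N * laxGauge N τ ν v u z := by
  have hz' : z + 1 ∉ lattice τ := by rwa [add_mem_lattice_iff (one_mem_lattice τ)]
  have hM : laxCM N τ ν v u (z + 1) = laxCM N τ ν v u z := by
    simp only [laxCM, phi_add_one hτ]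
  have := conj_mul_eq_mul_conj (P := -Q N) (X := Xi N τ u z) (D := 1) (Y := Xi N τ u (z + 1))
    (M := laxCM N τ ν v u z) (M' := laxCM N τ ν v u (z + 1))
    (by rw [Xi_add_one, Matrix.mul_one, Matrix.neg_mul]) (isUnit_det_Xi hτ hu hd hz) (by simp)
    (isUnit_det_Xi hτ hu hd hz') (by rw [hM, Matrix.mul_one, Matrix.one_mul])
  rwa [Matrix.mul_neg, Matrix.neg_mul, neg_inj] at this

lemma laxGauge_add_tau (hτ : 0 < τ.im) (hu : ∑ j, u j = 0)
    (hd : ∀ j k, j ≠ k → u j - u k ∉ lattice τ) (ν : ℂ) (v : Fin N → ℂ) {z : ℂ}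
    (hz : z ∉ lattice τ) :
    laxGauge N τ ν v u (z + τ) * Lam N = Lam N * laxGauge N τ ν v u z := by
  have hz' : z + τ ∉ lattice τ := by rwa [add_mem_lattice_iff (tau_mem_lattice τ)]
  have hD : IsUnit (Matrix.diagonal fun j => e (u j)).det := by
    rw [Matrix.det_diagonal, isUnit_iff_ne_zero, Finset.prod_ne_zero_iff]
    exact fun _ _ => e_ne_zero _
  have := conj_mul_eq_mul_conj (P := LamTilde N τ z) (X := Xi N τ u z) (Y := Xi N τ u (z + τ))
    (M := laxCM N τ ν v u z) (M' := laxCM N τ ν v u (z + τ)) (Xi_add_tau u z)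
    (isUnit_det_Xi hτ hu hd hz) hD (isUnit_det_Xi hτ hu hd hz') (by
      ext j k
      rw [Matrix.diagonal_mul, Matrix.mul_diagonal]
      simp only [laxCM, Matrix.of_apply]
      split_ifs with h
      · rw [h, mul_comm]
      · rw [phi_add_tau hτ, neg_sub, e_sub]
        field_simp [e_ne_zero])
  rw [LamTilde, Matrix.mul_smul, Matrix.smul_mul] at this
  exact smul_right_injective _ (neg_ne_zero.2 (e_ne_zero _)) this

lemma adjugate_Xi_zero_apply (hτ : 0 < τ.im) (hu : ∑ j, u j = 0)
    (hd : ∀ j k, j ≠ k → u j - u k ∉ lattice τ) (i i' j : Fin N) :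
    (Xi N τ u 0).adjugate i j = (Xi N τ u 0).adjugate i' j := by
  obtain ⟨c, -, h⟩ := exists_det_Xi_eq hτ hu hd
  have h0 : (Xi N τ u 0).det = 0 := by rw [h, vartheta_zero, mul_zero]
  have h1 : (fun i => (Xi N τ u 0).adjugate i j) ∈ LinearMap.ker (Xi N τ u 0).mulVecLin := by
    rw [LinearMap.mem_ker]
    funext i
    have := congrFun (congrFun (Matrix.mul_adjugate (Xi N τ u 0)) i) j
    rw [h0, zero_smul, Matrix.mul_apply] at this
    exact this
  rw [ker_Xi_zero (NeZero.ne N) hτ hu hd, Submodule.mem_span_singleton] at h1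
  obtain ⟨a, ha⟩ := h1
  exact (congrFun ha i).symm.trans (congrFun ha i')

lemma Xi_zero_mulVec_const (hτ : 0 < τ.im) (hu : ∑ j, u j = 0)
    (hd : ∀ j k, j ≠ k → u j - u k ∉ lattice τ) (a : ℂ) :
    Xi N τ u 0 *ᵥ (fun _ => a) = 0 := by
  have h : (fun _ : Fin N => a) ∈ LinearMap.ker (Xi N τ u 0).mulVecLin := by
    rw [ker_Xi_zero (NeZero.ne N) hτ hu hd, Submodule.mem_span_singleton]
    exact ⟨a, by ext; simp⟩
  exact h

/-- `ϑ ^ 2` times the gauge transform extends to an entire function that vanishes at `0`. -/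
lemma exists_entire_laxGauge (hτ : 0 < τ.im) (hu : ∑ j, u j = 0)
    (hd : ∀ j k, j ≠ k → u j - u k ∉ lattice τ) (ν : ℂ) (v : Fin N → ℂ) :
    ∃ A : ℂ → Matrix (Fin N) (Fin N) ℂ, (∀ i j, Differentiable ℂ fun z => A z i j) ∧
      (∀ z, z ∉ lattice τ → A z = vartheta z τ ^ 2 • laxGauge N τ ν v u z) ∧ A 0 = 0 := by
  obtain ⟨c, hc, h⟩ := exists_det_Xi_eq hτ hu hd
  refine ⟨fun z => c⁻¹ • (Xi N τ u z * laxCMNum N τ ν v u z * (Xi N τ u z).adjugate),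
    fun i j => ?_, fun z hz => ?_, ?_⟩
  · have hX := differentiable_Xi (NeZero.ne N) hτ u
    exact (differentiable_matrix_mul (differentiable_matrix_mul hX
      (differentiable_laxCMNum hτ ν v u)) (differentiable_matrix_adjugate hX) i j).const_mul c⁻¹
  · have h1 := vartheta_ne_zero hτ hz
    simp only [laxGauge, Matrix.inv_def, h, Ring.inverse_eq_inv', laxCMNum_eq hτ ν v u hz,
      Matrix.mul_smul, Matrix.smul_mul, smul_smul]
    congr 1
    field_simp
  · have h1 : laxCMNum N τ ν v u 0 * (Xi N τ u 0).adjugate =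
        (ν * deriv (fun w => vartheta w τ) 0 * (N - 1)) • (Xi N τ u 0).adjugate := by
      ext i j
      simp only [Matrix.mul_apply, Matrix.smul_apply, smul_eq_mul,
        fun k => adjugate_Xi_zero_apply hτ hu hd k i j, ← Finset.sum_mul]
      congr 1
      rw [← Finset.add_sum_erase _ _ (Finset.mem_univ i), Finset.sum_congr rfl
        (g := fun _ => ν * deriv (fun w => vartheta w τ) 0) fun k hk => ?_]
      · have : 1 ≤ N := NeZero.one_le
        simp [laxCMNum, vartheta_zero, Finset.card_erase_of_mem, Nat.cast_sub this]
        ring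
      · have hik : i ≠ k := by simpa [eq_comm] using hk
        have := vartheta_ne_zero hτ (hd i k hik)
        simp only [laxCMNum, Matrix.of_apply, if_neg hik, add_zero]
        field_simp
    dsimp only
    rw [Matrix.mul_assoc, h1, Matrix.mul_smul, Matrix.mul_adjugate, h, vartheta_zero]
    simp

end

/-! ### The rotator Lax operator -/

lemma quasiPeriodic_of_compl_lattice (hτ : 0 < τ.im) {K k : ℂ → ℂ} {α β : ℂ}
    (hK : Differentiable ℂ K) (h : ∀ z, z ∉ lattice τ → K z = vartheta z τ ^ 2 * k z)
    (h1 : ∀ z, z ∉ lattice τ → k (z + 1) = α * k z)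
    (h2 : ∀ z, z ∉ lattice τ → k (z + τ) = β * k z) :
    QuasiPeriodic τ 2 α (e (-τ) * β) K where
  differentiable := hK
  add_one := by
    refine fun z => congrFun (Continuous.ext_on (dense_compl_lattice τ)
      (hK.continuous.comp (by fun_prop)) (hK.continuous.const_mul _) fun z hz => ?_ :
      (fun z => K (z + 1)) = fun z => α * K z) z
    have hz' : z + 1 ∉ lattice τ := by rwa [add_mem_lattice_iff (one_mem_lattice τ)]
    simp only [h z hz, h _ hz', h1 z hz, (quasiPeriodic_vartheta hτ).add_one]
    ring
  add_tau := by
    have hc : Continuous fun z => e (-τ) * β * e (-((2 : ℕ) * z)) * K z :=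
      (continuous_const.mul (differentiable_e.continuous.comp (by fun_prop))).mul hK.continuous
    refine fun z => congrFun (Continuous.ext_on (dense_compl_lattice τ)
      (hK.continuous.comp (by fun_prop)) hc fun z hz => ?_ : (fun z => K (z + τ)) = _) z
    have hz' : z + τ ∉ lattice τ := by rwa [add_mem_lattice_iff (tau_mem_lattice τ)]
    simp only [h z hz, h _ hz', h2 z hz, (quasiPeriodic_vartheta hτ).add_tau]
    rw [show -τ = -(τ / 2) + -(τ / 2) by ring, show -((2 : ℕ) * z) = -((1 : ℕ) * z) +
      -((1 : ℕ) * z) by push_cast; ring, e_add, e_add]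
    ring

lemma char_notMem_lattice (hτ : 0 < τ.im) {m n : ℕ} (hm : m < N) (hn : n < N)
    (hmn : ¬(m = 0 ∧ n = 0)) : -(((m : ℂ) + n * τ) / N) ∉ lattice τ := by
  rw [neg_mem_lattice_iff]
  rintro ⟨a, b, h⟩
  have hN : (N : ℂ) ≠ 0 := Nat.cast_ne_zero.2 (by lia)
  rw [div_eq_iff hN] at h
  have him := congrArg Complex.im h
  have hre := congrArg Complex.re h
  simp at him hre
  have hn' : (n : ℝ) = b * N := mul_right_cancel₀ hτ.ne' (by linear_combination him)
  have hm' : (m : ℝ) = a * N := by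
    rw [hn'] at hre; linear_combination hre
  have hn2 : (n : ℤ) = b * N := by exact_mod_cast hn'
  have hm2 : (m : ℤ) = a * N := by exact_mod_cast hm'
  have key : ∀ (x : ℕ) (y : ℤ), x < N → (x : ℤ) = y * N → x = 0 := by
    intro x y hx hxy
    have h1 : y < 1 := by by_contra! h'; nlinarith
    have h2 : -1 < y := by by_contra! h'; nlinarith
    have : y = 0 := by lia
    subst this; lia
  exact hmn ⟨key m a hm hm2, key n b hn hn2⟩

lemma exists_sinCoeff_laxGauge_eq [NeZero N] (hτ : 0 < τ.im) {u : Fin N → ℂ} (hu : ∑ j, u j = 0)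
    (hd : ∀ j k, j ≠ k → u j - u k ∉ lattice τ) (ν : ℂ) (v : Fin N → ℂ) (p : SinIndex N) :
    ∃ S : ℂ, ∀ z, z ∉ lattice τ →
      sinCoeff p.1.1 p.1.2 (laxGauge N τ ν v u z) = S * phiChar N τ p z := by
  obtain ⟨⟨m, n⟩, hmn⟩ := p
  have hN : (N : ℂ) ≠ 0 := Nat.cast_ne_zero.2 (NeZero.ne N)
  simp only at hmn ⊢
  set c : ℂ := -((((m : ℕ) : ℂ) + ((n : ℕ) : ℂ) * τ) / N) with hc_def
  have hc : vartheta c τ ≠ 0 := vartheta_ne_zero hτ (char_notMem_lattice hτ m.2 n.2 hmn)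
  have hth := (quasiPeriodic_vartheta hτ).differentiable
  set α := e (-(((n : ℕ) : ℂ) / N))
  set β := e (((m : ℕ) : ℂ) / N)
  have hα : ‖α‖ = 1 := by
    rw [show α = e ((-((n : ℕ) / N) : ℝ) : ℂ) by push_cast; rfl, norm_e_ofReal]
  have hβ : ‖β‖ = 1 := by
    rw [show β = e ((((m : ℕ) / N) : ℝ) : ℂ) by push_cast; rfl, norm_e_ofReal]
  obtain ⟨A, hA, hAG, hA0⟩ := exists_entire_laxGauge hτ hu hd ν v
  have qA : QuasiPeriodic τ (1 + 1) α (e (-τ) * β) fun z => sinCoeff m n (A z) :=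
    quasiPeriodic_of_compl_lattice hτ (k := fun z => sinCoeff m n (laxGauge N τ ν v u z))
      (differentiable_sinCoeff hA m n) (fun z hz => by rw [hAG z hz, sinCoeff_smul])
      (fun z hz => sinCoeff_of_mul_Q (laxGauge_add_one hτ hu hd ν v hz) m n)
      (fun z hz => sinCoeff_of_mul_Lam (laxGauge_add_tau hτ hu hd ν v hz) m n)
  set ψ : ℂ → ℂ := fun z => e (-(((n : ℕ) : ℂ) * z / N)) *
    (vartheta (c + z) τ * deriv (fun w => vartheta w τ) 0 / vartheta c τ)
  have hψ : Differentiable ℂ ψ := (differentiable_e.comp (by fun_prop)).mul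
    (((hth.comp (by fun_prop : Differentiable ℂ fun z => c + z)).mul_const _).div_const _)
  have hψφ : ∀ z, z ∉ lattice τ → ψ z = vartheta z τ * phiChar N τ ⟨(m, n), hmn⟩ z := by
    intro z hz
    have := vartheta_ne_zero hτ hz
    simp only [ψ, phiChar, ← hc_def, phi]
    field_simp
  have qψ : QuasiPeriodic τ (1 + 1) α (e (-τ) * β) fun z => vartheta z τ * ψ z := by
    refine quasiPeriodic_of_compl_lattice hτ (k := phiChar N τ ⟨(m, n), hmn⟩) (hth.mul hψ)
      (fun z hz => by rw [hψφ z hz]; ring) (fun z _ => ?_) (fun z _ => ?_)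
    · simp only [phiChar, phi_add_one hτ]
      rw [show -(((n : ℕ) : ℂ) * (z + 1) / N) = -(((n : ℕ) : ℂ) / N) +
        -(((n : ℕ) : ℂ) * z / N) by ring, e_add]
      ring
    · simp only [phiChar, phi_add_tau hτ, neg_neg]
      rw [← mul_assoc, ← mul_assoc, ← e_add, ← e_add]
      congr 2
      field_simp
      ring
  have hβ' : e (-τ) * β ≠ 0 := mul_ne_zero (e_ne_zero _) (e_ne_zero _)
  obtain ⟨a, qa, ha⟩ := qA.exists_eq_vartheta_mul hτ (c := 0) (e_ne_zero _) hβ' (by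
    simp [hA0, sinCoeff])
  have qψ' := qψ.of_mul (d := 1) (d' := 1) (by simpa using quasiPeriodic_vartheta_sub hτ 0)
    (by norm_num) (neg_ne_zero.2 (e_ne_zero _))
    (by simpa using dense_vartheta_sub_ne_zero hτ 0) hψ fun z => rfl
  have hψ0 : ψ 0 ≠ 0 := by
    simp only [ψ, add_zero]
    refine mul_ne_zero (e_ne_zero _) (div_ne_zero (mul_ne_zero hc (deriv_vartheta_zero hτ)) hc)
  refine ⟨a 0 / ψ 0, ?_⟩
  rw [div_neg, div_one, div_neg, div_eq_mul_inv, ← e_neg, neg_neg, ← neg_mul] at qψ'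
  rw [sub_zero] at qa
  obtain ⟨b, qb, hb⟩ := (qa.add (qψ'.const_mul (-(a 0 / ψ 0)))).exists_eq_vartheta_mul hτ (c := 0)
    (neg_ne_zero.2 (e_ne_zero _))
    (mul_ne_zero (neg_ne_zero.2 hβ') (e_ne_zero _)) (by field_simp; ring)
  have hmult : - -(e (-τ) * β) * e (τ / 2) * e (τ / 2 - 0) = β := by
    have : e (-τ) * e (τ / 2) * e (τ / 2) = 1 := by rw [← e_add, ← e_add, ← e_zero]; congr 1; ring
    rw [sub_zero]
    linear_combination β * this
  rw [neg_neg, ← neg_mul, hmult] at qb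
  have hb0 := qb.eq_zero hτ hα hβ (by
    by_contra! h
    refine hmn ⟨e_natCast_div_injOn m.2 (NeZero.pos N) ?_,
      e_natCast_div_injOn n.2 (NeZero.pos N) ?_⟩
    · simpa using h.2
    · have := h.1
      simp only [e_neg, inv_eq_one] at this
      simpa using this)
  intro z hz
  have h1 := hb z
  rw [hb0, mul_zero] at h1
  have h2 := ha z
  rw [hAG z hz, sinCoeff_smul, sub_zero] at h2
  have h3 := vartheta_ne_zero hτ hz
  refine mul_left_cancel₀ (pow_ne_zero 2 h3) ?_
  rw [h2]
  linear_combination vartheta z τ * h1 + vartheta z τ * (a 0 / ψ 0) * hψφ z hz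

lemma trace_laxGauge [NeZero N] (hτ : 0 < τ.im) {u : Fin N → ℂ} (hu : ∑ j, u j = 0)
    (hd : ∀ j k, j ≠ k → u j - u k ∉ lattice τ) (ν : ℂ) {v : Fin N → ℂ} (hv : ∑ j, v j = 0)
    {z : ℂ} (hz : z ∉ lattice τ) : (laxGauge N τ ν v u z).trace = 0 := by
  rw [laxGauge, Matrix.trace_mul_comm, ← Matrix.mul_assoc,
    Matrix.nonsing_inv_mul _ (isUnit_det_Xi hτ hu hd hz), Matrix.one_mul, ← hv]
  simp [Matrix.trace, laxCM]

theorem exists_laxGauge_eq_laxRot [NeZero N] (hτ : 0 < τ.im) {u : Fin N → ℂ} (hu : ∑ j, u j = 0)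
    (hd : ∀ j k, j ≠ k → u j - u k ∉ lattice τ) (ν : ℂ) {v : Fin N → ℂ} (hv : ∑ j, v j = 0) :
    ∃ S : SinIndex N → ℂ, ∀ z, z ∉ lattice τ → laxGauge N τ ν v u z = laxRot N τ S z := by
  choose S hS using exists_sinCoeff_laxGauge_eq hτ hu hd ν v
  refine ⟨S, fun z hz => ?_⟩
  rw [eq_sum_sinCoeff (laxGauge N τ ν v u z), laxRot, ← Fintype.sum_subtype_add_sum_subtype
    fun p : Fin N × Fin N => ((p.1 : ℕ) = 0 ∧ (p.2 : ℕ) = 0)]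
  rw [Finset.sum_eq_zero fun p _ => ?_, zero_add]
  · refine Finset.sum_congr rfl fun p _ => ?_
    rw [hS p z hz]; rfl
  · rw [sinCoeff_zero_zero p.2.1 p.2.2, trace_laxGauge hτ hu hd ν hv hz, mul_zero, zero_smul]

/-! ### The residue of the rotator Lax operator -/

lemma tendsto_vartheta_div (τ : ℂ) (hτ : 0 < τ.im) :
    Tendsto (fun z => vartheta z τ / z) (𝓝[≠] 0) (𝓝 (deriv (fun w => vartheta w τ) 0)) := by
  have h := ((quasiPeriodic_vartheta hτ).differentiable 0).hasDerivAt.tendsto_slope_zero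
  refine h.congr fun z => ?_
  simp [vartheta_zero, div_eq_inv_mul]

lemma eventually_notMem_lattice (hτ : 0 < τ.im) : ∀ᶠ z in 𝓝[≠] (0 : ℂ), z ∉ lattice τ := by
  have h := ((quasiPeriodic_vartheta hτ).differentiable 0).hasDerivAt.eventually_ne
    (c := 0) (deriv_vartheta_zero hτ)
  filter_upwards [h] with z hz
  rwa [← vartheta_eq_zero_iff hτ]

lemma tendsto_mul_phi (hτ : 0 < τ.im) {c : ℂ} (hc : c ∉ lattice τ) :
    Tendsto (fun z => z * phi τ c z) (𝓝[≠] 0) (𝓝 1) := by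
  have hd := deriv_vartheta_zero hτ
  have hc' := vartheta_ne_zero hτ hc
  have h1 : Tendsto (fun z => vartheta (c + z) τ) (𝓝[≠] 0) (𝓝 (vartheta c τ)) := by
    have : Continuous fun z => vartheta (c + z) τ := (continuous_vartheta hτ).comp (by fun_prop)
    simpa using (this.tendsto 0).mono_left nhdsWithin_le_nhds
  have h2 := (((h1.mul_const (deriv (fun w => vartheta w τ) 0)).div_const (vartheta c τ))).mul
    ((tendsto_vartheta_div τ hτ).inv₀ hd)
  rw [mul_div_right_comm, div_self hc', one_mul, mul_inv_cancel₀ hd] at h2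
  refine h2.congr fun z => ?_
  rw [phi, inv_div, ← mul_div_assoc, div_mul_eq_mul_div, div_div, mul_comm _ z, mul_div_assoc]

lemma tendsto_mul_phiChar [NeZero N] (hτ : 0 < τ.im) (p : SinIndex N) :
    Tendsto (fun z => z * phiChar N τ p z) (𝓝[≠] 0) (𝓝 1) := by
  have h1 : Tendsto (fun z : ℂ => e (-(((p.1.2 : ℕ) : ℂ) * z / N))) (𝓝[≠] 0) (𝓝 1) := by
    have : Continuous fun z : ℂ => e (-(((p.1.2 : ℕ) : ℂ) * z / N)) :=
      differentiable_e.continuous.comp (by fun_prop)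
    simpa using (this.tendsto 0).mono_left nhdsWithin_le_nhds
  have h2 := h1.mul (tendsto_mul_phi hτ (char_notMem_lattice hτ p.1.1.2 p.1.2.2 p.2))
  rw [one_mul] at h2
  exact h2.congr fun z => by rw [phiChar]; ring

lemma tendsto_smul_laxRot [NeZero N] (hτ : 0 < τ.im) (S : SinIndex N → ℂ) :
    Tendsto (fun z => z • laxRot N τ S z) (𝓝[≠] 0) (𝓝 (rotVar N S)) := by
  have h : ∀ p : SinIndex N, Tendsto (fun z => (S p * (z * phiChar N τ p z)) • sinBasis N p)
      (𝓝[≠] 0) (𝓝 (S p • sinBasis N p)) := fun p => by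
    simpa using ((tendsto_mul_phiChar hτ p).const_mul (S p)).smul_const (sinBasis N p)
  refine (tendsto_finsetSum Finset.univ fun p _ => h p).congr fun z => ?_
  rw [laxRot, Finset.smul_sum]
  refine Finset.sum_congr rfl fun p _ => ?_
  rw [smul_smul]; congr 1; ring

lemma tendsto_smul_laxCM (hτ : 0 < τ.im) {u : Fin N → ℂ}
    (hd : ∀ j k, j ≠ k → u j - u k ∉ lattice τ) (ν : ℂ) (v : Fin N → ℂ) :
    Tendsto (fun z => z • laxCM N τ ν v u z) (𝓝[≠] 0) (𝓝 (residueCM N ν)) := by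
  refine tendsto_pi_nhds.2 fun j => tendsto_pi_nhds.2 fun k => ?_
  simp only [laxCM, residueCM, Matrix.smul_apply, Matrix.of_apply, smul_eq_mul]
  split_ifs with h
  · have : Tendsto (fun z : ℂ => z * v j) (𝓝 0) (𝓝 (0 * v j)) := tendsto_id.mul_const _
    rw [zero_mul] at this
    exact this.mono_left nhdsWithin_le_nhds
  · have := (tendsto_mul_phi hτ (hd j k h)).const_mul ν
    rw [mul_one] at this
    exact this.congr fun z => by ring

lemma tendsto_div_const_mul_vartheta (hτ : 0 < τ.im) {c : ℂ} (hc : c ≠ 0) {f : ℂ → ℂ}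
    (hf : Differentiable ℂ f) (h0 : f 0 = 0) :
    ∃ l, Tendsto (fun z => (c * vartheta z τ)⁻¹ * f z) (𝓝[≠] 0) (𝓝 l) := by
  have h1 : Tendsto (fun z => f z / z) (𝓝[≠] 0) (𝓝 (deriv f 0)) := by
    refine (hf 0).hasDerivAt.tendsto_slope_zero.congr fun z => ?_
    simp [h0, div_eq_inv_mul]
  have h2 := (((tendsto_vartheta_div τ hτ).const_mul c).inv₀
    (mul_ne_zero hc (deriv_vartheta_zero hτ))).mul h1
  refine ⟨_, h2.congr' ?_⟩
  filter_upwards [self_mem_nhdsWithin] with z hz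
  have hz' : z ≠ 0 := hz
  field_simp

lemma tendsto_mulVec {l : Filter ℂ} {A : ℂ → Matrix (Fin N) (Fin N) ℂ} {w : ℂ → Fin N → ℂ}
    {A₀ : Matrix (Fin N) (Fin N) ℂ} {w₀ : Fin N → ℂ} (hA : Tendsto A l (𝓝 A₀))
    (hw : Tendsto w l (𝓝 w₀)) : Tendsto (fun z => A z *ᵥ w z) l (𝓝 (A₀ *ᵥ w₀)) :=
  tendsto_pi_nhds.2 fun i => tendsto_finsetSum Finset.univ fun j _ =>
    (tendsto_pi_nhds.1 (tendsto_pi_nhds.1 hA i) j).mul (tendsto_pi_nhds.1 hw j)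

lemma residueCM_add_smul_one (ν : ℂ) :
    residueCM N ν + ν • (1 : Matrix (Fin N) (Fin N) ℂ) = Matrix.of fun _ _ => ν := by
  ext i j
  by_cases h : i = j <;> simp [residueCM, h]

section

variable {u : Fin N → ℂ} [NeZero N]

/-- `rotVar + ν` vanishes on the vectors that the adjugate of `Xi 0` annihilates. -/
lemma rotVar_add_mulVec_eq_zero (hτ : 0 < τ.im) (hu : ∑ j, u j = 0)
    (hd : ∀ j k, j ≠ k → u j - u k ∉ lattice τ) {ν : ℂ} {v : Fin N → ℂ} {S : SinIndex N → ℂ}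
    (hS : ∀ z, z ∉ lattice τ → laxGauge N τ ν v u z = laxRot N τ S z) {y : Fin N → ℂ}
    (hy : (Xi N τ u 0).adjugate *ᵥ y = 0) :
    (rotVar N S + ν • (1 : Matrix (Fin N) (Fin N) ℂ)) *ᵥ y = 0 := by
  obtain ⟨c, hc, hdet⟩ := exists_det_Xi_eq hτ hu hd
  have hX := differentiable_Xi (NeZero.ne N) hτ u
  have hXt : Tendsto (Xi N τ u) (𝓝[≠] 0) (𝓝 (Xi N τ u 0)) := by
    have : Continuous (Xi N τ u) := continuous_matrix fun i j => (hX i j).continuous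
    exact (this.tendsto 0).mono_left nhdsWithin_le_nhds
  have hη : ∀ i, ∃ l, Tendsto (fun z => ((Xi N τ u z)⁻¹ *ᵥ y) i) (𝓝[≠] 0) (𝓝 l) := by
    intro i
    have hf : Differentiable ℂ fun z => ((Xi N τ u z).adjugate *ᵥ y) i := by
      simp only [Matrix.mulVec, dotProduct]
      exact Differentiable.fun_sum fun j _ => (differentiable_matrix_adjugate hX i j).mul_const _
    obtain ⟨l, hl⟩ := tendsto_div_const_mul_vartheta hτ hc hf (congrFun hy i)
    refine ⟨l, hl.congr fun z => ?_⟩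
    rw [Matrix.inv_def, hdet, Ring.inverse_eq_inv', Matrix.smul_mulVec, Pi.smul_apply, smul_eq_mul]
  choose η hη using hη
  have hη' := tendsto_pi_nhds.2 hη
  have h1 := tendsto_mulVec hXt (tendsto_mulVec ((tendsto_smul_laxCM hτ hd ν v).add_const
    (ν • (1 : Matrix (Fin N) (Fin N) ℂ))) hη')
  have h2 := tendsto_mulVec ((tendsto_smul_laxRot hτ S).add_const (ν • (1 : Matrix (Fin N) (Fin N) ℂ)))
    (tendsto_const_nhds (x := y))
  have h3 : Xi N τ u 0 *ᵥ ((residueCM N ν + ν • (1 : Matrix (Fin N) (Fin N) ℂ)) *ᵥ η) = 0 := by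
    rw [residueCM_add_smul_one]
    exact Xi_zero_mulVec_const hτ hu hd (∑ j, ν * η j)
  rw [h3] at h1
  refine tendsto_nhds_unique h2 (h1.congr' ?_)
  filter_upwards [eventually_notMem_lattice hτ] with z hz
  have hu' := isUnit_det_Xi hτ hu hd hz
  rw [← hS z hz, laxGauge, Matrix.mulVec_mulVec, Matrix.mulVec_mulVec, Matrix.mul_add,
    Matrix.add_mul, Matrix.mul_smul, Matrix.mul_smul, Matrix.smul_mul, Matrix.smul_mul,
    Matrix.mul_one, Matrix.mul_nonsing_inv _ hu']

lemma trace_rotVar (hτ : 0 < τ.im) (hu : ∑ j, u j = 0)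
    (hd : ∀ j k, j ≠ k → u j - u k ∉ lattice τ) {ν : ℂ} {v : Fin N → ℂ} (hv : ∑ j, v j = 0)
    {S : SinIndex N → ℂ} (hS : ∀ z, z ∉ lattice τ → laxGauge N τ ν v u z = laxRot N τ S z) :
    (rotVar N S).trace = 0 := by
  have hc : Continuous fun A : Matrix (Fin N) (Fin N) ℂ => A.trace :=
    continuous_id.matrix_trace
  refine tendsto_nhds_unique ((hc.tendsto _).comp (tendsto_smul_laxRot hτ S))
    (tendsto_const_nhds.congr' ?_)
  filter_upwards [eventually_notMem_lattice hτ] with z hz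
  rw [Function.comp_apply, ← hS z hz, Matrix.trace_smul, trace_laxGauge hτ hu hd ν hv hz,
    smul_zero]

lemma exists_rotVar_add_eq_vecMulVec (hτ : 0 < τ.im) (hu : ∑ j, u j = 0)
    (hd : ∀ j k, j ≠ k → u j - u k ∉ lattice τ) {ν : ℂ} {v : Fin N → ℂ} {S : SinIndex N → ℂ}
    (hS : ∀ z, z ∉ lattice τ → laxGauge N τ ν v u z = laxRot N τ S z) :
    ∃ a r : Fin N → ℂ,
      rotVar N S + ν • (1 : Matrix (Fin N) (Fin N) ℂ) = Matrix.vecMulVec a r := by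
  set M := rotVar N S + ν • (1 : Matrix (Fin N) (Fin N) ℂ)
  set r : Fin N → ℂ := (Xi N τ u 0).adjugate 0
  have hM : ∀ y, r ⬝ᵥ y = 0 → M *ᵥ y = 0 := fun y hy =>
    rotVar_add_mulVec_eq_zero hτ hu hd hS (funext fun i => (Finset.sum_congr rfl fun j _ =>
      congrArg (· * y j) (adjugate_Xi_zero_apply hτ hu hd i 0 j)).trans hy)
  by_cases hr : ∃ j, r j ≠ 0
  · obtain ⟨j, hj⟩ := hr
    refine ⟨M *ᵥ Pi.single j (r j)⁻¹, r, Matrix.ext_of_mulVec_single fun k => ?_⟩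
    have h1 := hM (Pi.single k 1 - r k • Pi.single j (r j)⁻¹) (by
      rw [dotProduct_sub, dotProduct_smul, dotProduct_single, dotProduct_single,
        mul_inv_cancel₀ hj, smul_eq_mul, mul_one, sub_self])
    rw [Matrix.mulVec_sub, Matrix.mulVec_smul, sub_eq_zero] at h1
    rw [h1]
    ext i
    simp [Matrix.vecMulVec_apply, mul_comm, mul_left_comm]
  · push Not at hr
    refine ⟨0, 0, Matrix.ext_of_mulVec_single fun k => ?_⟩
    rw [hM _ (by simp [hr])]
    ext i
    simp

end

/-- A traceless matrix `R` for which `R + ν` has rank one is conjugate to `residueCM`. -/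
lemma exists_specialLinear_conj (hN : N ≠ 0) {ν : ℂ} (hν : ν ≠ 0)
    {R : Matrix (Fin N) (Fin N) ℂ} (hR : R.trace = 0) {a r : Fin N → ℂ}
    (h : R + ν • (1 : Matrix (Fin N) (Fin N) ℂ) = Matrix.vecMulVec a r) :
    ∃ g : Matrix.SpecialLinearGroup (Fin N) ℂ,
      R = ((g⁻¹ : Matrix.SpecialLinearGroup (Fin N) ℂ) : Matrix (Fin N) (Fin N) ℂ) *
        residueCM N ν * (g : Matrix (Fin N) (Fin N) ℂ) := by
  have hN' : (N : ℂ) ≠ 0 := Nat.cast_ne_zero.2 hN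
  have har : r ⬝ᵥ a = N * ν := by
    have h1 := congrArg Matrix.trace h
    rw [Matrix.trace_add, hR, Matrix.trace_smul, Matrix.trace_one, Fintype.card_fin,
      Matrix.trace_vecMulVec, zero_add, smul_eq_mul] at h1
    rw [dotProduct_comm, ← h1, mul_comm]
  have ha : a ≠ 0 := by
    rintro rfl
    rw [dotProduct_zero] at har
    exact mul_ne_zero hN' hν har.symm
  have hν1 : (fun _ : Fin N => ν) ≠ 0 := fun h0 =>
    hν (congrFun h0 ⟨0, Nat.pos_of_ne_zero hN⟩)
  obtain ⟨A, hA⟩ := SeparatingDual.exists_continuousLinearEquiv_apply_eq (R := ℂ) ha hν1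
  set B := LinearMap.toMatrix' (A.toLinearEquiv : (Fin N → ℂ) →ₗ[ℂ] (Fin N → ℂ))
  set C := LinearMap.toMatrix' (A.symm.toLinearEquiv : (Fin N → ℂ) →ₗ[ℂ] (Fin N → ℂ))
  have hBa : B *ᵥ a = fun _ => ν := by
    rw [LinearMap.toMatrix'_mulVec]; exact hA
  have hCB : C * B = 1 := by
    rw [← LinearMap.toMatrix'_comp, ← LinearMap.toMatrix'_id]
    congr 1
    ext x : 1
    simp
  have hBdet : B.det ≠ 0 := fun h0 => by
    have := congrArg Matrix.det hCB
    rw [Matrix.det_mul, h0, mul_zero, Matrix.det_one] at this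
    exact zero_ne_one this
  set s : Fin N → ℂ := r ᵥ* C
  have hsB : s ᵥ* B = r := by rw [Matrix.vecMul_vecMul, hCB, Matrix.vecMul_one]
  have hs : ∑ j, s j = N := by
    have h1 : s ⬝ᵥ (fun _ => ν) = N * ν := by
      rw [← hBa, Matrix.dotProduct_mulVec, hsB, har]
    simp only [dotProduct, ← Finset.sum_mul] at h1
    exact mul_right_cancel₀ hν h1
  set q : Fin N → ℂ := fun j => (s j - 1) / N
  have hq : ∑ j, q j = 0 := by
    simp only [q, ← Finset.sum_div, Finset.sum_sub_distrib, hs]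
    simp
  set G : Matrix (Fin N) (Fin N) ℂ := 1 + Matrix.vecMulVec (fun _ => 1) q
  have hGdet : G.det = 1 := by
    have := Matrix.det_one_add_replicateCol_mul_replicateRow (ι := Unit) (fun _ : Fin N => (1 : ℂ)) q
    rw [← Matrix.vecMulVec_eq] at this
    rw [this]
    simp [dotProduct, hq]
  have hGν : G *ᵥ (fun _ => ν) = fun _ => ν := by
    funext i
    simp [G, Matrix.add_mulVec, Matrix.vecMulVec_mulVec, dotProduct, ← Finset.sum_mul, hq]
  have hG1 : (fun _ => ν) ᵥ* G = ν • s := by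
    funext j
    simp [G, Matrix.vecMul_add, Matrix.vecMul_vecMulVec, dotProduct, q]
    field_simp
    ring
  have hconj : (G * B) * R = residueCM N ν * (G * B) := by
    have h1 : (G * B) * (R + ν • (1 : Matrix (Fin N) (Fin N) ℂ)) =
        (residueCM N ν + ν • (1 : Matrix (Fin N) (Fin N) ℂ)) * (G * B) := by
      rw [h, residueCM_add_smul_one, Matrix.mul_vecMulVec, ← Matrix.mulVec_mulVec, hBa, hGν]
      ext i j
      have h2 : ((fun _ => ν) ᵥ* (G * B)) j = ν * r j := by
        rw [← Matrix.vecMul_vecMul, hG1, Matrix.smul_vecMul, hsB]; rfl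
      rw [Matrix.vecMulVec_apply, ← h2]
      rfl
    simpa [Matrix.mul_add, Matrix.add_mul] using h1
  obtain ⟨t, ht⟩ := IsAlgClosed.exists_pow_nat_eq (B.det)⁻¹ (Nat.pos_of_ne_zero hN)
  have hdet : (t • (G * B)).det = 1 := by
    rw [Matrix.det_smul, Fintype.card_fin, ht, Matrix.det_mul, hGdet, one_mul,
      inv_mul_cancel₀ hBdet]
  refine ⟨⟨t • (G * B), hdet⟩, ?_⟩
  set g : Matrix.SpecialLinearGroup (Fin N) ℂ := ⟨t • (G * B), hdet⟩ with hg
  have hgR : (g : Matrix (Fin N) (Fin N) ℂ) * R = residueCM N ν * g := by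
    change (t • (G * B)) * R = residueCM N ν * (t • (G * B))
    rw [Matrix.smul_mul, Matrix.mul_smul, hconj]
  rw [Matrix.mul_assoc, ← hgR, ← Matrix.mul_assoc, ← Matrix.SpecialLinearGroup.coe_mul,
    inv_mul_cancel, Matrix.SpecialLinearGroup.coe_one, Matrix.one_mul]

end CMRotator

open CMRotator in
theorem lemma4p3 (N : ℕ) (hN : 1 ≤ N) (τ : ℂ) (hτ : 0 < τ.im)
    (u : Fin N → ℂ) (hu : ∑ j, u j = 0) :
    -- singularity, and the vector lies in the kernel, for every `u`
    ((XiTilde N τ u 0).det = 0 ∧ XiTilde N τ u 0 *ᵥ kerVec N τ u = 0) ∧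
    -- for points that are distinct modulo the lattice:
    ((∀ j k, j ≠ k → u j - u k ∉ lattice τ) →
      -- the kernel is the line spanned by the vector
      (kerVec N τ u ≠ 0 ∧
        LinearMap.ker (XiTilde N τ u 0).mulVecLin = Submodule.span ℂ {kerVec N τ u}) ∧
      -- `Xi` is holomorphic and intertwines the multipliers of the two bundles
      (∀ i j, Differentiable ℂ fun z => Xi N τ u z i j) ∧
      (∀ z, Xi N τ u (z + 1) = -(Q N * Xi N τ u z)) ∧
      (∀ z, Xi N τ u (z + τ) =
        LamTilde N τ z * Xi N τ u z * Matrix.diagonal fun j => e (u j)) ∧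
      -- it is invertible off the lattice, and degenerates to first order at `z = 0`
      (∀ z, z ∉ lattice τ → IsUnit (Xi N τ u z).det) ∧
      analyticOrderAt (fun z => (Xi N τ u z).det) 0 = 1 ∧
      LinearMap.ker (Xi N τ u 0).mulVecLin = Submodule.span ℂ {fun _ => (1 : ℂ)} ∧
      -- it conjugates the Calogero-Moser Lax operator to a rotator Lax operator
      -- on the coadjoint orbit of the residue
      (∀ (ν : ℂ) (v : Fin N → ℂ), ∑ j, v j = 0 →
        ∃ S : SinIndex N → ℂ,
          (∀ z, z ∉ lattice τ →
            Xi N τ u z * laxCM N τ ν v u z * (Xi N τ u z)⁻¹ = laxRot N τ S z) ∧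
          (ν ≠ 0 → ∃ g : Matrix.SpecialLinearGroup (Fin N) ℂ,
            rotVar N S =
              ((g⁻¹ : Matrix.SpecialLinearGroup (Fin N) ℂ) : Matrix (Fin N) (Fin N) ℂ) *
                residueCM N ν * (g : Matrix (Fin N) (Fin N) ℂ)))) := by
  have : NeZero N := ⟨by lia⟩
  have hN' := NeZero.ne N
  refine ⟨⟨det_XiTilde_zero hN' hτ hu, XiTilde_zero_mulVec_kerVec hN' hτ hu⟩, fun hd =>
    ⟨ker_XiTilde_zero hN' hτ hu hd, differentiable_Xi hN' hτ u, Xi_add_one u, Xi_add_tau u,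
      fun z hz => isUnit_det_Xi hτ hu hd hz, ?_, ker_Xi_zero hN' hτ hu hd, fun ν v hv => ?_⟩⟩
  · obtain ⟨c, hc, h⟩ := exists_det_Xi_eq hτ hu hd
    simp only [h]
    exact analyticOrderAt_const_mul_vartheta hτ hc
  · obtain ⟨S, hS⟩ := exists_laxGauge_eq_laxRot hτ hu hd ν hv
    refine ⟨S, hS, fun hν => ?_⟩
    obtain ⟨a, r, har⟩ := exists_rotVar_add_eq_vecMulVec hτ hu hd hS
    exact exists_specialLinear_conj hN' hν (trace_rotVar hτ hu hd hv hS) har
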